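/- **Setting.** An election $E=(C,V)$ consists of a finite set $C$ of $m$ candidates and finitely many voters, each with a linear order over $C$. Labels $\lambda_1,\dots,\lambda_\ell$ are subsets of $C$. A set $X\subseteq C$ satisfies the constraint $\mathrm{Interval}(p,q,\lambda_i)$ if $p\le |X\cap\lambda_i|\le q$, and the constraint $\mathrm{Dominance}(\lambda_i,\lambda_j)$ if $|X\cap\lambda_i|\ge|X\cap\lambda_j|$. An instance of the *constrained winner election problem* consists of an election, a committee size $k$, labels, a finite list $\mathfrak C$ of interval and dominance constraints, and a routine $R$ that, given the instance data and two sets $X,Y\subseteq C$, answers whether $X\succeq Y$, where $\succeq$ is a weak order (a total, transitive relation) on $2^C$. The task is to output a set $X\subseteq C$ with $|X|=k$ that satisfies all constraints in $\mathfrak C$ and such that $X\succeq Y$ for every $Y\subseteq C$ with $|Y|=k$ satisfying all constraints in $\mathfrak C$; if no set of size $k$ satisfies $\mathfrak C$, this has to be reported. The size of an instance is the length of the encoding of the election, $k$ and the constraints (with all numbers in binary) and of the labels (as subsets of $C$). The order $\succeq$ is *fixed-cardinality responsive* if, whenever $X\succeq Y$, $|X|=|Y|$ and $Z\cap X=Z\cap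 Y=\emptyset$, then $X\cup Z\succeq Y\cup Z$. The *dominance graph* of an instance is the transitive closure of the directed graph with a vertex for every label and an edge $(\lambda_x,\lambda_y)$ for every constraint $\mathrm{Dominance}(\lambda_x,\lambda_y)$ in $\mathfrak C$. It is *tree-like* if there are no vertices $x\ne y$ and $z$ such that $(x,z)$ and $(y,z)$ are edges but neither $(x,y)$ nor $(y,x)$ is an edge. **Theorem.** The constrained winner election problem, with both interval and dominance constraints, can be solved in polynomial time on the instances in which 1. the order $\succeq$ over committees satisfies fixed-cardinality responsiveness, 2. $\succeq$ is computable in polynomial time, 3. the labels are pairwise disjoint, and 4. the dominance graph is tree-like. Precisely, there is one algorithm $M$, which may call the routine $R$, such that for every polynomial $Q$ there is a polynomial $P$ with the following property: on every instance satisfying 1, 3 and 4 whose routine $R$ decides $X\succeq Y$ within time $Q$ (in the size of its input), $M$ halts with a correct output within time $P$ (in the size of the instance), where the time spent by $R$ is included. -/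

import Mathlib

namespace ConstrainedElection

/-! ### The machine model: while-programs over binary trees, with a running time -/

/-- The data on which programs operate: finite binary trees (LISP data with one atom). -/
inductive Data : Type
  | nil : Data
  | cons (a b : Data) : Data

namespace Data

/-- Number of nodes of a tree. -/
def size : Data → ℕ
  | nil => 1
  | cons a b => a.size + b.size + 1

def head : Data → Data
  | nil => nil
  | cons a _ => a

def tail : Data → Data
  | nil => nil
  | cons _ b => b

/-- Booleans: `nil` is NO, `cons nil nil` is YES. -/
def ofBool : Bool → Data
  | false => nil
  | true => cons nil nil

/-- Lists of data, in the usual right-nested form. -/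
def ofList : List Data → Data
  | [] => nil
  | a :: l => cons a (ofList l)

/-- Natural numbers in binary (least significant bit first). -/
def ofNat (n : ℕ) : Data := ofList (n.bits.map ofBool)

/-- A subset of `{0, …, m - 1}` as its characteristic vector of length `m`. -/
def ofFinset {m : ℕ} (X : Finset (Fin m)) : Data :=
  ofList (List.ofFn fun c : Fin m => ofBool (decide (c ∈ X)))

end Data

/-- Programs. Each program transforms one tree, its current datum. The command `call` is a call
to an external routine, to be supplied by `Prog.link`. -/
inductive Prog : Type
  | skip : Prog
  | empty : Prog
  | head : Prog
  | tail : Prog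
  | pair (p q : Prog) : Prog
  | seq (p q : Prog) : Prog
  | cond (c p q : Prog) : Prog
  | loop (c p : Prog) : Prog
  | call : Prog

/-- `M.link R` is the program `M` in which each `call` has been replaced by the routine `R`. -/
def Prog.link (M R : Prog) : Prog :=
  match M with
  | .skip => .skip
  | .empty => .empty
  | .head => .head
  | .tail => .tail
  | .pair p q => .pair (p.link R) (q.link R)
  | .seq p q => .seq (p.link R) (q.link R)
  | .cond c p q => .cond (c.link R) (p.link R) (q.link R)
  | .loop c p => .loop (c.link R) (p.link R)
  | .call => R

/-- `Runs p x y t`: the program `p`, started on `x`, halts with the result `y` after time `t`.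
Every elementary step is charged the full size of the datum it is applied to (so no datum is ever
copied, created or discarded for free, and the running time bounds the size of the result).
In `cond c p q` and `loop c p`, the result of `c` on the current datum is the test, `nil` meaning
false and any other tree meaning true; `loop c p` is `while c do p`.
An unlinked `call` does not run. -/
inductive Runs : Prog → Data → Data → ℕ → Prop
  | skip (x : Data) : Runs .skip x x x.size
  | empty (x : Data) : Runs .empty x .nil x.size
  | head (x : Data) : Runs .head x x.head x.size
  | tail (x : Data) : Runs .tail x x.tail x.size
  | pair {p q : Prog} {x a b : Data} {s t : ℕ} :
      Runs p x a s → Runs q x b t → Runs (.pair p q) x (.cons a b) (x.size + s + t)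
  | seq {p q : Prog} {x y z : Data} {s t : ℕ} :
      Runs p x y s → Runs q y z t → Runs (.seq p q) x z (x.size + s + t)
  | cond_true {c p q : Prog} {x u v y : Data} {s t : ℕ} :
      Runs c x (.cons u v) s → Runs p x y t → Runs (.cond c p q) x y (x.size + s + t)
  | cond_false {c p q : Prog} {x y : Data} {s t : ℕ} :
      Runs c x .nil s → Runs q x y t → Runs (.cond c p q) x y (x.size + s + t)
  | loop_stop {c p : Prog} {x : Data} {s : ℕ} :
      Runs c x .nil s → Runs (.loop c p) x x (x.size + s)
  | loop_step {c p : Prog} {x u v y z : Data} {s t r : ℕ} :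
      Runs c x (.cons u v) s → Runs p x y t → Runs (.loop c p) y z r →
        Runs (.loop c p) x z (x.size + s + t + r)

/-- On input `x`, the program `p` halts with result `y` within time `P (size of x)`. -/
def RunsWithin (P : Polynomial ℕ) (p : Prog) (x y : Data) : Prop :=
  ∃ t : ℕ, Runs p x y t ∧ t ≤ P.eval x.size

/-! ### Elections, labels and constraints -/

/-- An election with candidates `0, …, m - 1`. Each voter is given by a linear order over the
candidates, listed from best to worst: `σ i` is the candidate that `σ` ranks in position `i`. -/
structure Election where
  m : ℕ
  voters : List (Equiv.Perm (Fin m))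

/-- Constraints over `l` labels: `interval p q i` asks for between `p` and `q` members with label
`i`, and `dominance i j` for at least as many members with label `i` as with label `j`. -/
inductive Constraint (l : ℕ) : Type
  | interval (p q : ℕ) (i : Fin l) : Constraint l
  | dominance (i j : Fin l) : Constraint l

/-- The input of the constrained winner election problem, apart from the order over committees:
an election, the committee size `k`, labels (each one a set of candidates) and constraints. -/
structure Input where
  election : Election
  k : ℕ
  numLabels : ℕ
  label : Fin numLabels → Finset (Fin election.m)
  constraints : List (Constraint numLabels)

namespace Input

/-- Sets of candidates of the election. -/
abbrev Committee (I : Input) : Type := Finset (Fin I.election.m)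

/-- The set of candidates `X` satisfies a constraint. -/
def Satisfies (I : Input) (X : I.Committee) : Constraint I.numLabels → Prop
  | .interval p q i => p ≤ (X ∩ I.label i).card ∧ (X ∩ I.label i).card ≤ q
  | .dominance i j => (X ∩ I.label j).card ≤ (X ∩ I.label i).card

/-- `X` is a committee of size `k` that satisfies all constraints. -/
def Feasible (I : Input) (X : I.Committee) : Prop :=
  X.card = I.k ∧ ∀ c ∈ I.constraints, I.Satisfies X c

/-- The labels are pairwise disjoint. -/
def DisjointLabels (I : Input) : Prop :=
  ∀ i j : Fin I.numLabels, i ≠ j → Disjoint (I.label i) (I.label j)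

/-- Edges of the dominance graph: the transitive closure of the dominance constraints. -/
def DominanceEdge (I : Input) : Fin I.numLabels → Fin I.numLabels → Prop :=
  Relation.TransGen fun i j => Constraint.dominance i j ∈ I.constraints

/-- The dominance graph is tree-like: two distinct labels with edges to a common label are joined
by an edge, in one direction or the other. -/
def TreeLike (I : Input) : Prop :=
  ¬ ∃ x y z : Fin I.numLabels, x ≠ y ∧ I.DominanceEdge x z ∧ I.DominanceEdge y z ∧
    ¬ I.DominanceEdge x y ∧ ¬ I.DominanceEdge y x

end Input

/-! ### Orders over committees -/

/-- `ge X Y` (read: `X` is at least as good as `Y`) is a weak order: total and transitive. -/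
def IsWeakOrder {α : Type} (ge : α → α → Prop) : Prop :=
  (∀ X Y, ge X Y ∨ ge Y X) ∧ ∀ X Y Z, ge X Y → ge Y Z → ge X Z

/-- Fixed-cardinality responsiveness. -/
def FixedCardinalityResponsive {α : Type} [DecidableEq α]
    (ge : Finset α → Finset α → Prop) : Prop :=
  ∀ X Y Z : Finset α, X.card = Y.card → Disjoint Z X → Disjoint Z Y →
    ge X Y → ge (X ∪ Z) (Y ∪ Z)

/-- What has to be returned: a committee that is best among the feasible ones, or the answer
that there is no feasible committee. -/
def IsSolution (I : Input) (ge : I.Committee → I.Committee → Prop) : Option I.Committee → Prop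
  | some X => I.Feasible X ∧ ∀ Y, I.Feasible Y → ge X Y
  | none => ∀ Y, ¬ I.Feasible Y

/-! ### Encodings -/

/-- The list of candidates, followed by the preference orders of the voters. -/
def Election.encode (E : Election) : Data :=
  .cons (Data.ofList (List.ofFn fun c : Fin E.m => Data.ofNat c))
    (Data.ofList (E.voters.map fun σ => Data.ofList (List.ofFn fun i => Data.ofNat (σ i))))

def Constraint.encode {l : ℕ} : Constraint l → Data
  | .interval p q i =>
      .cons (Data.ofBool true) (.cons (Data.ofNat p) (.cons (Data.ofNat q) (Data.ofNat i)))
  | .dominance i j => .cons (Data.ofBool false) (.cons (Data.ofNat i) (Data.ofNat j))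

def Input.encode (I : Input) : Data :=
  .cons I.election.encode (.cons (Data.ofNat I.k)
    (.cons (Data.ofList (List.ofFn fun i => Data.ofFinset (I.label i)))
      (Data.ofList (I.constraints.map Constraint.encode))))

/-- The question "is `X` at least as good as `Y` in `I`?". -/
def encodeQuery (I : Input) (X Y : I.Committee) : Data :=
  .cons I.encode (.cons (Data.ofFinset X) (Data.ofFinset Y))

def encodeOutput {I : Input} : Option I.Committee → Data
  | none => .nil
  | some X => .cons .nil (Data.ofFinset X)

/-- The routine `R` computes the order `ge` over the committees of `I`, in time bounded by the
polynomial `Q` in the size of the question. -/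
def ComputesOrder (Q : Polynomial ℕ) (R : Prog) (I : Input)
    (ge : I.Committee → I.Committee → Prop) : Prop :=
  ∀ X Y : I.Committee,
    (ge X Y → RunsWithin Q R (encodeQuery I X Y) (Data.ofBool true)) ∧
    (¬ ge X Y → RunsWithin Q R (encodeQuery I X Y) (Data.ofBool false))

end ConstrainedElection

open ConstrainedElection

namespace ConstrainedElection

/-! ### Running times -/

/-! The candidates split into disjoint blocks: the labels and the class of unlabelled candidates.
Constraints see a committee only through its label counts, and responsiveness makes the optimisation
local. Replacing the part of a committee inside one block by an at least as good part of the same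
size does not make the committee worse, and replacements in disjoint blocks combine
(`Replaces.union`). So among the partial committees of one block that agree in size and in the one
label count still needed, a single best one can stand for all (`prune_covers`, `Replaces.prune`).

The algorithm keeps one node per block: a representative label and a table with at most one entry
for each pair (count in that label, size), hence at most `(m + 1) ^ 2` entries. The initial tables
hold best subsets of each block of every size, filtered by the interval constraints. Nodes `u` and
`v` may be merged when every dominance relation between `v` and a third node passes through `u`.
Once the dominances between `u` and `v` have been checked on the joined table, the count of `v` can
be forgotten and `u` represents both blocks (`LiveInv.merge`).

Tree-likeness always supplies such a pair (`LiveInv.exists_mergeable`). Let `v` be a lowest node and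
`u` a lowest one among the other nodes above `v`; any further node above `v` is comparable with `u`,
and therefore lies above `u`. If nothing else is above `v`, then `v` is unrelated to all others and
any `u` will do. Each round removes one node until a single table describes the whole candidate set,
and its best entry of size `k` is the answer (`select_isSolution`, `solve_isSolution`).

The running time is treated separately (`exists_solver`). Functions computed by programs in
polynomial time (`Comp`) are closed under composition, case distinction, and folds whose
intermediate values stay polynomially bounded. For the algorithm these bounds come from counting
signatures (`length_le_of_pairwise`, `LiveOK.esize_le`). -/

theorem eval_mono (P : Polynomial ℕ) {a b : ℕ} (h : a ≤ b) : P.eval a ≤ P.eval b := by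
  rw [Polynomial.eval_eq_sum_range, Polynomial.eval_eq_sum_range]
  gcongr

theorem Data.one_le_size (x : Data) : 1 ≤ x.size := by
  cases x <;> simp [Data.size]

/-- Every step is charged at least the size of what it produces. A time bound is thus also a bound
on the output, so polynomial time bounds compose without a separate size analysis. -/
theorem Runs.size_le {p : Prog} {x y : Data} {t : ℕ} (h : Runs p x y t) : y.size ≤ t := by
  induction h with
  | skip x => exact le_rfl
  | empty x => exact x.one_le_size
  | head x => cases x <;> simp [Data.head, Data.size]; omega
  | tail x => cases x <;> simp [Data.tail, Data.size]; omega
  | @pair p q x a b s t h₁ h₂ ih₁ ih₂ =>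
    have := x.one_le_size
    simp only [Data.size]; omega
  | seq h₁ h₂ ih₁ ih₂ => omega
  | cond_true h₁ h₂ ih₁ ih₂ => omega
  | cond_false h₁ h₂ ih₁ ih₂ => omega
  | loop_stop h ih => omega
  | loop_step h₁ h₂ h₃ ih₁ ih₂ ih₃ => omega

/-- `p` transforms `x` into `y` within time `T`. -/
def RunsIn (p : Prog) (x y : Data) (T : ℕ) : Prop := ∃ t, Runs p x y t ∧ t ≤ T

theorem RunsIn.mono {p : Prog} {x y : Data} {S T : ℕ} (h : RunsIn p x y S) (hST : S ≤ T) :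
    RunsIn p x y T := by
  obtain ⟨t, h, ht⟩ := h
  exact ⟨t, h, ht.trans hST⟩

theorem RunsIn.size_le {p : Prog} {x y : Data} {T : ℕ} (h : RunsIn p x y T) : y.size ≤ T := by
  obtain ⟨t, h, ht⟩ := h
  exact h.size_le.trans ht

theorem Runs.runsIn {p : Prog} {x y : Data} {t : ℕ} (h : Runs p x y t) : RunsIn p x y t :=
  ⟨t, h, le_rfl⟩

theorem RunsIn.pair {p q : Prog} {x a b : Data} {S T : ℕ} (h₁ : RunsIn p x a S)
    (h₂ : RunsIn q x b T) : RunsIn (.pair p q) x (.cons a b) (x.size + S + T) := by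
  obtain ⟨s, h₁, hs⟩ := h₁
  obtain ⟨t, h₂, ht⟩ := h₂
  exact ⟨_, .pair h₁ h₂, by omega⟩

theorem RunsIn.seq {p q : Prog} {x y z : Data} {S T : ℕ} (h₁ : RunsIn p x y S)
    (h₂ : RunsIn q y z T) : RunsIn (.seq p q) x z (x.size + S + T) := by
  obtain ⟨s, h₁, hs⟩ := h₁
  obtain ⟨t, h₂, ht⟩ := h₂
  exact ⟨_, .seq h₁ h₂, by omega⟩

theorem RunsIn.cond_true {c p q : Prog} {x u v y : Data} {S T : ℕ}
    (h₁ : RunsIn c x (.cons u v) S) (h₂ : RunsIn p x y T) :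
    RunsIn (.cond c p q) x y (x.size + S + T) := by
  obtain ⟨s, h₁, hs⟩ := h₁
  obtain ⟨t, h₂, ht⟩ := h₂
  exact ⟨_, .cond_true h₁ h₂, by omega⟩

theorem RunsIn.cond_false {c p q : Prog} {x y : Data} {S T : ℕ}
    (h₁ : RunsIn c x .nil S) (h₂ : RunsIn q x y T) :
    RunsIn (.cond c p q) x y (x.size + S + T) := by
  obtain ⟨s, h₁, hs⟩ := h₁
  obtain ⟨t, h₂, ht⟩ := h₂
  exact ⟨_, .cond_false h₁ h₂, by omega⟩

/-- One pass of the loop of `foldProg`: from `(s, g :: l, e)` to `(step (s, g, e), l, e)`. -/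
def foldBody (step : Prog) : Prog :=
  .pair (.seq (.pair .head (.pair (.seq .tail (.seq .head .head)) (.seq .tail .tail))) step)
    (.pair (.seq .tail (.seq .head .tail)) (.seq .tail .tail))

/-- Programs have a single datum and no variables, so the loop carries the triple (state, remaining
list, environment); the test reads the remaining list. -/
def foldLoop (step : Prog) : Prog := .loop (.seq .tail .head) (foldBody step)

/-- A left fold over the list computed by `list`, started at the result of `init`. -/
def foldProg (init list step : Prog) : Prog :=
  .seq (.pair init (.pair list .skip)) (.seq (foldLoop step) .head)

theorem foldBody_runsIn {p : Prog} {s g l e s' : Data} {T : ℕ}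
    (h : RunsIn p (.cons s (.cons g e)) s' T) :
    RunsIn (foldBody p) (.cons s (.cons (.cons g l) e)) (.cons s' (.cons l e))
      (T + 32 * (s.size + (Data.cons g l).size + e.size + 2)) := by
  obtain ⟨t, h, ht⟩ := h
  refine ⟨_, .pair (.seq (.pair (.head _) (.pair (.seq (.tail _) (.seq (.head _) (.head _)))
    (.seq (.tail _) (.tail _)))) h) (.pair (.seq (.tail _) (.seq (.head _) (.tail _)))
    (.seq (.tail _) (.tail _))), ?_⟩
  simp only [Data.size, Data.head, Data.tail]
  omega

/-- Both bounds are demanded only for states actually reached, that is, for folds over prefixes of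
the list. The constant 36 is 32 for one pass of the body plus 4 for the test and the charge of the
loop itself. -/
theorem foldLoop_runsIn {σ γ : Type} {es : σ → Data} {eg : γ → Data} {step : σ → γ → σ}
    {p : Prog} {e : Data} {B L T : ℕ} (l : List γ) (s : σ)
    (hL : (Data.ofList (l.map eg)).size ≤ L)
    (hB : ∀ l₁ l₂, l = l₁ ++ l₂ → (es (l₁.foldl step s)).size ≤ B)
    (hT : ∀ l₁ g l₂, l = l₁ ++ g :: l₂ → RunsIn p
      (.cons (es (l₁.foldl step s)) (.cons (eg g) e)) (es (step (l₁.foldl step s) g)) T) :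
    RunsIn (foldLoop p) (.cons (es s) (.cons (Data.ofList (l.map eg)) e))
      (.cons (es (l.foldl step s)) (.cons .nil e))
      ((l.length + 1) * (T + 36 * (B + L + e.size + 2))) := by
  induction l generalizing s with
  | nil =>
    have h0 := hB [] [] rfl
    simp only [List.foldl_nil] at h0
    simp only [List.map_nil, Data.ofList, Data.size, List.foldl_nil, List.length_nil] at hL ⊢
    refine ⟨_, Runs.loop_stop (.seq (.tail _) (.head _)), ?_⟩
    simp only [Data.size, Data.tail]
    omega
  | cons g l ih =>
    have h0 := hB [] _ rfl
    simp only [List.foldl_nil] at h0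
    have hstep := foldBody_runsIn (l := Data.ofList (l.map eg)) (hT [] g l rfl)
    simp only [List.foldl_nil] at hstep
    simp only [List.map_cons, Data.ofList, Data.size] at hL
    obtain ⟨t, hrun, ht⟩ := ih (step s g) (by omega)
      (fun l₁ l₂ h => by simpa using hB (g :: l₁) l₂ (by simp [h]))
      (fun l₁ g' l₂ h => by simpa using hT (g :: l₁) g' l₂ (by simp [h]))
    obtain ⟨t', hstep, ht'⟩ := hstep
    refine ⟨_, .loop_step (.seq (.tail _) (.head _)) hstep hrun, ?_⟩
    simp only [Data.size, Data.tail, List.length_cons, List.map_cons, Data.ofList]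
      at ht' ⊢
    have : (l.length + 1 + 1) * (T + 36 * (B + L + e.size + 2)) =
      (l.length + 1) * (T + 36 * (B + L + e.size + 2)) + (T + 36 * (B + L + e.size + 2)) := by
      ring
    rw [this]
    omega

theorem length_lt_size_ofList (l : List Data) : l.length < (Data.ofList l).size := by
  induction l with
  | nil => simp [Data.ofList, Data.size]
  | cons a l ih =>
    have := a.one_le_size
    simp only [Data.ofList, Data.size, List.length_cons]; omega

theorem foldProg_runsIn {σ γ : Type} {es : σ → Data} {eg : γ → Data} {step : σ → γ → σ}
    {pi pl p : Prog} {e : Data} {B L T : ℕ} (l : List γ) (s : σ)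
    (hs : RunsIn pi e (es s) B)
    (hl : RunsIn pl e (Data.ofList (l.map eg)) L)
    (hB : ∀ l₁ l₂, l = l₁ ++ l₂ → (es (l₁.foldl step s)).size ≤ B)
    (hT : ∀ l₁ g l₂, l = l₁ ++ g :: l₂ → RunsIn p
      (.cons (es (l₁.foldl step s)) (.cons (eg g) e)) (es (step (l₁.foldl step s) g)) T) :
    RunsIn (foldProg pi pl p) e (es (l.foldl step s))
      ((L + 1) * (T + 36 * (B + L + e.size + 2)) + 12 * (B + L + e.size + 2)) := by
  -- A list is shorter than its encoding, so the time bound `L` for producing the list also bounds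
  -- the number of passes.
  have hlen := (length_lt_size_ofList (l.map eg)).le.trans hl.size_le
  rw [List.length_map] at hlen
  refine (RunsIn.seq (hs.pair (hl.pair (Runs.skip e).runsIn))
    ((foldLoop_runsIn l s hl.size_le hB hT).seq (Runs.head _).runsIn)).mono ?_
  have h1 := hB l [] (by simp)
  have h2 := hs.size_le
  have h3 := hl.size_le
  have : (l.length + 1) * (T + 36 * (B + L + e.size + 2)) ≤
      (L + 1) * (T + 36 * (B + L + e.size + 2)) := by gcongr
  simp only [Data.size]
  omega

/-! ### Encodable types -/

/-- Neither injectivity nor decoding is required: programs are only claimed to map encodings to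
encodings. The instances below are chosen so that tuples, sums and options reproduce the prescribed
encodings of inputs, queries and outputs. -/
class Enc (α : Type) where
  enc : α → Data

open Enc

instance : Enc Bool := ⟨Data.ofBool⟩
instance : Enc ℕ := ⟨Data.ofNat⟩
instance : Enc Unit := ⟨fun _ => .nil⟩
instance {α : Type} [Enc α] : Enc (List α) := ⟨fun l => Data.ofList (l.map enc)⟩
instance {α β : Type} [Enc α] [Enc β] : Enc (α × β) := ⟨fun x => .cons (enc x.1) (enc x.2)⟩
instance {α β : Type} [Enc α] [Enc β] : Enc (α ⊕ β) :=
  ⟨Sum.elim (fun a => .cons (Data.ofBool true) (enc a)) (fun b => .cons (Data.ofBool false) (enc b))⟩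
instance {α : Type} [Enc α] : Enc (Option α) :=
  ⟨fun o => o.elim .nil fun a => .cons .nil (enc a)⟩

/-- Size of the encoding. -/
def esize {α : Type} [Enc α] (a : α) : ℕ := (enc a).size

section Size
variable {α β : Type} [Enc α] [Enc β]

theorem enc_pair_size (a : α) (b : β) : (enc (a, b)).size = (enc a).size + (enc b).size + 1 := rfl

@[simp] theorem esize_pair (a : α) (b : β) : esize (a, b) = esize a + esize b + 1 := rfl

@[simp] theorem esize_nil : esize ([] : List α) = 1 := rfl

@[simp] theorem esize_cons (a : α) (l : List α) : esize (a :: l) = esize a + esize l + 1 := rfl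

theorem esize_append (l l' : List α) : esize (l ++ l') + 1 = esize l + esize l' := by
  induction l with
  | nil => simp; omega
  | cons a l ih => simp only [List.cons_append, esize_cons]; omega

@[simp] theorem esize_reverse (l : List α) : esize l.reverse = esize l := by
  induction l with
  | nil => rfl
  | cons a l ih =>
    have := esize_append l.reverse [a]
    simp only [esize_cons, esize_nil, List.reverse_cons] at *; omega

theorem esize_bool_le (b : Bool) : esize b ≤ 3 := by
  cases b <;> simp [esize, enc, Data.ofBool, Data.size]

theorem esize_le_of_mem {a : α} {l : List α} (h : a ∈ l) : esize a ≤ esize l := by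
  induction l with
  | nil => simp at h
  | cons b l ih =>
    simp only [esize_cons]
    rcases List.mem_cons.1 h with rfl | h
    · omega
    · have := ih h; omega

theorem esize_list_le {l : List α} {n B : ℕ} (hn : l.length ≤ n) (h : ∀ a ∈ l, esize a ≤ B) :
    esize l ≤ n * (B + 1) + 1 := by
  refine le_trans ?_ (Nat.add_le_add_right (Nat.mul_le_mul_right (B + 1) hn) 1)
  clear hn
  induction l with
  | nil => simp
  | cons a l ih =>
    have := ih fun b hb => h b (List.mem_cons_of_mem _ hb)
    have := h a List.mem_cons_self
    simp only [esize_cons, List.length_cons, add_mul]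
    omega

theorem length_lt_esize (l : List α) : l.length < esize l := by
  induction l with
  | nil => simp
  | cons a l ih => simp only [esize_cons, List.length_cons]; omega

theorem esize_le_of_sublist {l l' : List α} (h : l.Sublist l') : esize l ≤ esize l' := by
  induction h with
  | slnil => simp
  | cons a _ ih => simp only [esize_cons]; omega
  | cons_cons a _ ih => simp only [esize_cons]; omega

end Size

/-! ### Functions computable in polynomial time -/

/-- An input of the problem, with an order over its committees and a routine that computes it. -/
structure Ctx where
  I : Input
  ge : I.Committee → I.Committee → Prop
  R : Prog
  Q : Polynomial ℕ
  computes : ComputesOrder Q R I ge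

/-- `f` is computed on `D` by a program that may call the routine, in polynomial time. -/
def Comp {α β : Type} [Enc α] [Enc β] (D : Ctx → α → Prop) (f : Ctx → α → β) : Prop :=
  ∃ p : Prog, ∀ Q : Polynomial ℕ, ∃ P : Polynomial ℕ, ∀ c : Ctx, c.Q = Q → ∀ a, D c a →
    RunsIn (p.link c.R) (enc a) (enc (f c a)) (P.eval (esize a))

namespace Comp
variable {α β γ δ σ : Type} [Enc α] [Enc β] [Enc γ] [Enc δ] [Enc σ]
  {D D' : Ctx → α → Prop}

theorem mono {f : Ctx → α → β} (h : Comp D f) (hD : ∀ c a, D' c a → D c a) : Comp D' f := by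
  obtain ⟨p, h⟩ := h
  refine ⟨p, fun Q => ?_⟩
  obtain ⟨P, h⟩ := h Q
  exact ⟨P, fun c hc a ha => h c hc a (hD c a ha)⟩

/-- Programs see encodings only, so the same program computes any function with the same encoded
values, even one of another type. This turns numbers into bit lists and pairs into list cells at no
cost. -/
theorem congr_enc {f : Ctx → α → β} {g : Ctx → α → γ} (h : Comp D f)
    (hfg : ∀ c a, D c a → enc (g c a) = enc (f c a)) : Comp D g := by
  obtain ⟨p, h⟩ := h
  refine ⟨p, fun Q => ?_⟩
  obtain ⟨P, h⟩ := h Q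
  exact ⟨P, fun c hc a ha => hfg c a ha ▸ h c hc a ha⟩

theorem congr {f g : Ctx → α → β} (h : Comp D f) (hfg : ∀ c a, D c a → g c a = f c a) :
    Comp D g :=
  h.congr_enc fun c a ha => by rw [hfg c a ha]

/-- Polynomial bound on the output size. -/
theorem size_bound {f : Ctx → α → β} (h : Comp D f) (Q : Polynomial ℕ) :
    ∃ P : Polynomial ℕ, ∀ c : Ctx, c.Q = Q → ∀ a, D c a → esize (f c a) ≤ P.eval (esize a) := by
  obtain ⟨p, h⟩ := h
  obtain ⟨P, h⟩ := h Q
  exact ⟨P, fun c hc a ha => (h c hc a ha).size_le⟩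

theorem id' : Comp D (fun _ a => a) :=
  ⟨.skip, fun _ => ⟨.X, fun _ _ a _ => (Runs.skip (enc a)).runsIn.mono (by simp [esize])⟩⟩

/-- The time bound `P₁` of the first program also bounds the size of the input of the second, hence
the term `P₂.comp P₁`. -/
theorem comp {D₁ : Ctx → β → Prop} {g : Ctx → β → γ} {f : Ctx → α → β} (hg : Comp D₁ g)
    (hf : Comp D f) (h : ∀ c a, D c a → D₁ c (f c a)) : Comp D (fun c a => g c (f c a)) := by
  obtain ⟨p, hf⟩ := hf
  obtain ⟨q, hg⟩ := hg
  refine ⟨.seq p q, fun Q => ?_⟩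
  obtain ⟨P₁, hf⟩ := hf Q
  obtain ⟨P₂, hg⟩ := hg Q
  refine ⟨.X + P₁ + P₂.comp P₁, fun c hc a ha => ?_⟩
  have h₁ := hf c hc a ha
  refine (h₁.seq (hg c hc _ (h c a ha))).mono ?_
  have := eval_mono P₂ h₁.size_le
  simp only [Polynomial.eval_add, Polynomial.eval_X, Polynomial.eval_comp]
  exact Nat.add_le_add_left this _

theorem pair {f : Ctx → α → β} {g : Ctx → α → γ} (hf : Comp D f) (hg : Comp D g) :
    Comp D (fun c a => (f c a, g c a)) := by
  obtain ⟨p, hf⟩ := hf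
  obtain ⟨q, hg⟩ := hg
  refine ⟨.pair p q, fun Q => ?_⟩
  obtain ⟨P₁, hf⟩ := hf Q
  obtain ⟨P₂, hg⟩ := hg Q
  refine ⟨.X + P₁ + P₂, fun c hc a ha => ?_⟩
  exact ((hf c hc a ha).pair (hg c hc a ha)).mono (by simp [esize])

/-- The constant program with value `d`. -/
def constProg : Data → Prog
  | .nil => .empty
  | .cons a b => .pair (constProg a) (constProg b)

theorem constProg_runsIn (d : Data) (R : Prog) (x : Data) :
    RunsIn ((constProg d).link R) x d (d.size * x.size) := by
  induction d with
  | nil => exact (Runs.empty x).runsIn.mono (by simp [Data.size])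
  | cons a b iha ihb =>
    refine (iha.pair ihb).mono ?_
    simp only [Data.size]
    apply le_of_eq; ring

theorem const (b : β) : Comp D (fun _ _ => b) :=
  ⟨constProg (enc b), fun _ => ⟨.C (esize b) * .X, fun c _ a _ => by
    simpa [esize] using constProg_runsIn (enc b) c.R (enc a)⟩⟩

theorem fst_id {D : Ctx → α × β → Prop} : Comp D (fun _ a => a.1) :=
  ⟨.head, fun _ => ⟨.X, fun _ _ a _ => (Runs.head (enc a)).runsIn.mono (by simp [esize])⟩⟩

theorem snd_id {D : Ctx → α × β → Prop} : Comp D (fun _ a => a.2) :=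
  ⟨.tail, fun _ => ⟨.X, fun _ _ a _ => (Runs.tail (enc a)).runsIn.mono (by simp [esize])⟩⟩

/-- Composition with a function that is computable on its whole domain. -/
theorem app {g : Ctx → β → γ} {f : Ctx → α → β} (hg : Comp (fun _ _ => True) g)
    (hf : Comp D f) : Comp D (fun c a => g c (f c a)) :=
  hg.comp hf fun _ _ _ => trivial

theorem app₂ {h : Ctx → β → γ → δ} {f : Ctx → α → β} {g : Ctx → α → γ}
    (hh : Comp (fun _ _ => True) (fun c (x : β × γ) => h c x.1 x.2))
    (hf : Comp D f) (hg : Comp D g) : Comp D (fun c a => h c (f c a) (g c a)) :=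
  hh.app (hf.pair hg)

theorem fst {f : Ctx → α → β × γ} (hf : Comp D f) : Comp D (fun c a => (f c a).1) :=
  app (g := fun _ x => x.1) fst_id hf

theorem snd {f : Ctx → α → β × γ} (hf : Comp D f) : Comp D (fun c a => (f c a).2) :=
  app (g := fun _ x => x.2) snd_id hf

theorem cons {f : Ctx → α → β} {g : Ctx → α → List β} (hf : Comp D f) (hg : Comp D g) :
    Comp D (fun c a => f c a :: g c a) :=
  (hf.pair hg).congr_enc fun _ _ _ => rfl

theorem some {f : Ctx → α → β} (hf : Comp D f) : Comp D (fun c a => Option.some (f c a)) :=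
  ((const ()).pair hf).congr_enc fun _ _ _ => rfl

/-- Case distinction on whether an encoding is `nil`. -/
theorem branch {t : Ctx → α → β} {f g h : Ctx → α → γ} {Dt Df : Ctx → α → Prop}
    (ht : Comp D t) (hf : Comp Dt f) (hg : Comp Df g)
    (H : ∀ c a, D c a → (enc (t c a) = .nil ∧ Df c a ∧ h c a = g c a) ∨
      ((∃ u v, enc (t c a) = .cons u v) ∧ Dt c a ∧ h c a = f c a)) : Comp D h := by
  obtain ⟨r, ht⟩ := ht
  obtain ⟨p, hf⟩ := hf
  obtain ⟨q, hg⟩ := hg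
  refine ⟨.cond r p q, fun Q => ?_⟩
  obtain ⟨P₁, ht⟩ := ht Q
  obtain ⟨P₂, hf⟩ := hf Q
  obtain ⟨P₃, hg⟩ := hg Q
  refine ⟨.X + P₁ + (P₂ + P₃), fun c hc a ha => ?_⟩
  have h₁ := ht c hc a ha
  simp only [Polynomial.eval_add, Polynomial.eval_X]
  rcases H c a ha with ⟨h₂, h₃, h₄⟩ | ⟨⟨u, v, h₂⟩, h₃, h₄⟩ <;> rw [h₂] at h₁ <;> rw [h₄]
  · exact (h₁.cond_false (hg c hc a h₃)).mono (by simp only [esize]; omega)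
  · exact (h₁.cond_true (hf c hc a h₃)).mono (by simp only [esize]; omega)

theorem ite {b : Ctx → α → Bool} {f g : Ctx → α → β} (hb : Comp D b) (hf : Comp D f)
    (hg : Comp D g) : Comp D (fun c a => if b c a then f c a else g c a) :=
  hb.branch hf hg fun c a ha => by
    cases h : b c a
    · exact .inl ⟨rfl, ha, by simp⟩
    · exact .inr ⟨⟨_, _, rfl⟩, ha, by simp⟩

theorem sumElim {s : Ctx → α → β ⊕ γ} {f : Ctx → α → β → δ} {g : Ctx → α → γ → δ}
    {D₁ : Ctx → β × α → Prop} {D₂ : Ctx → γ × α → Prop}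
    (hs : Comp D s) (hf : Comp D₁ (fun c (x : β × α) => f c x.2 x.1))
    (hg : Comp D₂ (fun c (x : γ × α) => g c x.2 x.1))
    (h₁ : ∀ c a b, D c a → s c a = .inl b → D₁ c (b, a) := by intros; exact True.intro)
    (h₂ : ∀ c a b, D c a → s c a = .inr b → D₂ c (b, a) := by intros; exact True.intro) :
    Comp D (fun c a => Sum.elim (f c a) (g c a) (s c a)) := by
  obtain ⟨r, hs⟩ := hs
  obtain ⟨p, hf⟩ := hf
  obtain ⟨q, hg⟩ := hg
  refine ⟨.seq (.pair r .skip) (.cond (.seq .head .head) (.seq (.pair (.seq .head .tail) .tail) p)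
    (.seq (.pair (.seq .head .tail) .tail) q)), fun Q => ?_⟩
  obtain ⟨P₁, hs⟩ := hs Q
  obtain ⟨P₂, hf⟩ := hf Q
  obtain ⟨P₃, hg⟩ := hg Q
  -- Each branch receives the payload paired with the original datum, of size at most `P₁ + X + 1`;
  -- both branch bounds are added because either may be taken.
  refine ⟨20 * (.X + P₁ + 1) + P₂.comp (P₁ + .X + 1) + P₃.comp (P₁ + .X + 1),
    fun c hc a ha => ?_⟩
  have h := hs c hc a ha
  have hsz := h.size_le
  simp only [Polynomial.eval_add, Polynomial.eval_X, Polynomial.eval_mul, Polynomial.eval_comp,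
    Polynomial.eval_ofNat, Polynomial.eval_one]
  cases hsa : s c a with
  | inl b =>
    rw [hsa] at h hsz
    change (Data.cons (.cons .nil .nil) (enc b)).size ≤ _ at hsz
    change RunsIn _ _ (.cons (.cons .nil .nil) (enc b)) _ at h
    have hp := hf c hc (b, a) (h₁ c a b ha hsa)
    have hm := eval_mono P₂ (a := esize (b, a)) (b := P₁.eval (esize a) + esize a + 1)
      (by simp only [Data.size, esize, enc_pair_size] at hsz ⊢; omega)
    refine ((h.pair (Runs.skip _).runsIn).seq (RunsIn.cond_true (u := .nil) (v := .nil)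
      ((Runs.head _).runsIn.seq (Runs.head _).runsIn)
      (RunsIn.seq (((Runs.head _).runsIn.seq (Runs.tail _).runsIn).pair
        (Runs.tail _).runsIn) hp))).mono ?_
    simp only [Data.size, esize, Data.head] at hsz hm ⊢
    omega
  | inr b =>
    rw [hsa] at h hsz
    change (Data.cons .nil (enc b)).size ≤ _ at hsz
    change RunsIn _ _ (.cons .nil (enc b)) _ at h
    have hp := hg c hc (b, a) (h₂ c a b ha hsa)
    have hm := eval_mono P₃ (a := esize (b, a)) (b := P₁.eval (esize a) + esize a + 1)
      (by simp only [Data.size, esize, enc_pair_size] at hsz ⊢; omega)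
    refine ((h.pair (Runs.skip _).runsIn).seq (RunsIn.cond_false
      ((Runs.head _).runsIn.seq (Runs.head _).runsIn)
      (RunsIn.seq (((Runs.head _).runsIn.seq (Runs.tail _).runsIn).pair
        (Runs.tail _).runsIn) hp))).mono ?_
    simp only [Data.size, esize, Data.head] at hsz hm ⊢
    omega

end Comp

/-- Case distinction on lists. -/
def listElim {γ β : Type} (n : β) (f : γ → List γ → β) : List γ → β
  | [] => n
  | g :: l => f g l

@[simp] theorem listElim_nil {γ β : Type} (n : β) (f : γ → List γ → β) : listElim n f [] = n := rfl

@[simp] theorem listElim_cons {γ β : Type} (n : β) (f : γ → List γ → β) (g : γ) (l : List γ) :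
    listElim n f (g :: l) = f g l := rfl

namespace Comp
variable {α β γ δ σ : Type} [Enc α] [Enc β] [Enc γ] [Enc δ] [Enc σ]
  {D D' : Ctx → α → Prop}

theorem listElim {l : Ctx → α → List γ} {n : Ctx → α → β} {f : Ctx → α → γ → List γ → β}
    {D₁ : Ctx → γ × List γ × α → Prop} (hl : Comp D l) (hn : Comp D n)
    (hf : Comp D₁ (fun c (x : γ × List γ × α) => f c x.2.2 x.1 x.2.1))
    (h₁ : ∀ c a g t, D c a → l c a = g :: t → D₁ c (g, t, a) := by intros; exact True.intro) :
    Comp D (fun c a => listElim (n c a) (f c a) (l c a)) := by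
  obtain ⟨r, hl⟩ := hl
  obtain ⟨q, hn⟩ := hn
  obtain ⟨p, hf⟩ := hf
  refine ⟨.seq (.pair r .skip) (.cond .head
    (.seq (.pair (.seq .head .head) (.pair (.seq .head .tail) .tail)) p)
    (.seq .tail q)), fun Q => ?_⟩
  obtain ⟨P₁, hl⟩ := hl Q
  obtain ⟨P₂, hf⟩ := hf Q
  obtain ⟨P₃, hn⟩ := hn Q
  refine ⟨20 * (.X + P₁ + 1) + P₂.comp (P₁ + .X + 1) + P₃, fun c hc a ha => ?_⟩
  have h := hl c hc a ha
  have hsz := h.size_le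
  simp only [Polynomial.eval_add, Polynomial.eval_X, Polynomial.eval_mul, Polynomial.eval_comp,
    Polynomial.eval_ofNat, Polynomial.eval_one]
  cases hla : l c a with
  | nil =>
    rw [hla] at h hsz
    change RunsIn _ _ .nil _ at h
    refine ((h.pair (Runs.skip _).runsIn).seq (RunsIn.cond_false (Runs.head _).runsIn
      (RunsIn.seq (Runs.tail _).runsIn (hn c hc a ha)))).mono ?_
    simp only [Data.size, esize] at hsz ⊢
    omega
  | cons g t =>
    rw [hla] at h hsz
    change RunsIn _ _ (.cons (enc g) (enc t)) _ at h
    change (Data.cons (enc g) (enc t)).size ≤ _ at hsz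
    have hp := hf c hc (g, t, a) (h₁ c a g t ha hla)
    have hm := eval_mono P₂ (a := esize (g, t, a)) (b := P₁.eval (esize a) + esize a + 1)
      (by simp only [Data.size, esize, enc_pair_size] at hsz ⊢; omega)
    refine ((h.pair (Runs.skip _).runsIn).seq (RunsIn.cond_true (Runs.head _).runsIn
      (RunsIn.seq (((Runs.head _).runsIn.seq (Runs.head _).runsIn).pair
        (((Runs.head _).runsIn.seq (Runs.tail _).runsIn).pair (Runs.tail _).runsIn)) hp))).mono ?_
    simp only [Data.size, esize, Data.head] at hsz hm ⊢
    omega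

/-- Left folds, when the intermediate results stay polynomially bounded. -/
theorem foldl {l : Ctx → α → List γ} {s₀ : Ctx → α → σ} {step : Ctx → α → σ → γ → σ}
    {D₁ : Ctx → σ × γ × α → Prop}
    (hl : Comp D l) (hs : Comp D s₀)
    (hstep : Comp D₁ (fun c (x : σ × γ × α) => step c x.2.2 x.1 x.2.1))
    (h₁ : ∀ c a l₁ g l₂, D c a → l c a = l₁ ++ g :: l₂ →
      D₁ c (l₁.foldl (step c a) (s₀ c a), g, a))
    (hB : ∀ Q : Polynomial ℕ, ∃ B : Polynomial ℕ, ∀ c : Ctx, c.Q = Q → ∀ a l₁ l₂, D c a →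
      l c a = l₁ ++ l₂ → esize (l₁.foldl (step c a) (s₀ c a)) ≤ B.eval (esize a)) :
    Comp D (fun c a => (l c a).foldl (step c a) (s₀ c a)) := by
  obtain ⟨pl, hl⟩ := hl
  obtain ⟨ps, hs⟩ := hs
  obtain ⟨p, hstep⟩ := hstep
  refine ⟨foldProg ps pl p, fun Q => ?_⟩
  obtain ⟨L, hl⟩ := hl Q
  obtain ⟨S, hs⟩ := hs Q
  obtain ⟨T, hstep⟩ := hstep Q
  obtain ⟨B, hB⟩ := hB Q
  -- `foldProg_runsIn` uses one number both for the time of the initialisation and for the size of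
  -- the states, hence `B + S`. The step receives a state, a list entry and the environment, of
  -- total size at most `B + L + X + 2`.
  refine ⟨(L + 1) * (T.comp (B + L + .X + 2) + 36 * ((B + S) + L + .X + 2)) +
    12 * ((B + S) + L + .X + 2), fun c hc a ha => ?_⟩
  have key := foldProg_runsIn (e := enc a) (es := enc) (eg := enc) (step := step c a)
    (pi := ps.link c.R) (pl := pl.link c.R) (p := p.link c.R)
    (B := (B + S).eval (esize a)) (L := L.eval (esize a))
    (T := T.eval (B.eval (esize a) + L.eval (esize a) + esize a + 2)) (l c a) (s₀ c a)
    ((hs c hc a ha).mono (by simp)) (hl c hc a ha)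
    (fun l₁ l₂ h => (hB c hc a l₁ l₂ ha h).trans (by simp)) fun l₁ g l₂ h => by
      refine (hstep c hc (_, g, a) (h₁ c a l₁ g l₂ ha h)).mono (eval_mono T ?_)
      have h₂ := hB c hc a l₁ _ ha h
      have h₃ : esize g ≤ esize (l c a) := esize_le_of_mem (by simp [h])
      have h₄ : esize (l c a) ≤ _ := (hl c hc a ha).size_le
      simp only [esize_pair]
      omega
  refine key.mono (le_of_eq ?_)
  simp [esize]

/-- Left folds with an invariant that bounds the size of the intermediate results. -/
theorem foldl_of_inv {l : Ctx → α → List γ} {s₀ : Ctx → α → σ} {step : Ctx → α → σ → γ → σ}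
    {D₁ : Ctx → σ × γ × α → Prop} (Inv : Ctx → α → σ → Prop)
    (hl : Comp D l) (hs : Comp D s₀)
    (hstep : Comp D₁ (fun c (x : σ × γ × α) => step c x.2.2 x.1 x.2.1))
    (h₀ : ∀ c a, D c a → Inv c a (s₀ c a))
    (h₁ : ∀ c a s g, D c a → Inv c a s → g ∈ l c a → D₁ c (s, g, a) ∧ Inv c a (step c a s g))
    (B : Polynomial ℕ) (hB : ∀ c a s, D c a → Inv c a s → esize s ≤ B.eval (esize a)) :
    Comp D (fun c a => (l c a).foldl (step c a) (s₀ c a)) := by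
  have key : ∀ c a, D c a → ∀ l₁ l₂, l c a = l₁ ++ l₂ →
      Inv c a (l₁.foldl (step c a) (s₀ c a)) := by
    intro c a ha l₁
    induction l₁ using List.reverseRecOn with
    | nil => intro _ _; exact h₀ c a ha
    | append_singleton l₁ g ih =>
      intro l₂ h
      rw [List.foldl_append]
      exact (h₁ c a _ g ha (ih (g :: l₂) (by simpa using h)) (by simp [h])).2
  refine foldl hl hs hstep (fun c a l₁ g l₂ ha h => ?_) fun _ => ⟨B, fun c _ a l₁ l₂ ha h => ?_⟩
  · exact (h₁ c a _ g ha (key c a ha _ _ h) (by simp [h])).1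
  · exact hB c a _ ha (key c a ha _ _ h)

end Comp

/-! ### Boolean and list operations in polynomial time -/

namespace Comp
variable {α β γ δ σ : Type} [Enc α] [Enc β] [Enc γ] [Enc δ] [Enc σ]
  {D D' : Ctx → α → Prop}

theorem not {b : Ctx → α → Bool} (hb : Comp D b) : Comp D (fun c a => !b c a) :=
  (hb.ite (const false) (const true)).congr fun c a _ => by cases b c a <;> rfl

theorem and {b b' : Ctx → α → Bool} (hb : Comp D b) (hb' : Comp D b') :
    Comp D (fun c a => b c a && b' c a) :=
  (hb.ite hb' (const false)).congr fun c a _ => by cases b c a <;> rfl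

theorem or {b b' : Ctx → α → Bool} (hb : Comp D b) (hb' : Comp D b') :
    Comp D (fun c a => b c a || b' c a) :=
  (hb.ite (const true) hb').congr fun c a _ => by cases b c a <;> rfl

theorem any {l : Ctx → α → List γ} {f : Ctx → α → γ → Bool} {D₁ : Ctx → γ × α → Prop}
    (hl : Comp D l) (hf : Comp D₁ (fun c (x : γ × α) => f c x.2 x.1))
    (h₁ : ∀ c a g, D c a → g ∈ l c a → D₁ c (g, a) := by intros; exact True.intro) :
    Comp D (fun c a => (l c a).any (f c a)) := by
  refine (foldl_of_inv (step := fun c a b g => b || f c a g) (s₀ := fun _ _ => false)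
    (D₁ := fun c x => D₁ c x.2) (fun _ _ _ => True) hl (const _) (fst_id.or ?_)
    (fun _ _ _ => trivial) (fun c a s g ha _ hg => ⟨h₁ c a g ha hg, trivial⟩) 3
    (fun c a s _ _ => (esize_bool_le s).trans (by simp))).congr fun c a _ => ?_
  · exact hf.comp snd_id fun _ _ h => h
  · have key : ∀ (l : List γ) (b : Bool),
        l.foldl (fun b g => b || f c a g) b = (b || l.any (f c a)) := by
      intro l
      induction l with
      | nil => simp
      | cons g l ih => intro b; simp [ih, Bool.or_assoc]
    simp [key]

theorem all {l : Ctx → α → List γ} {f : Ctx → α → γ → Bool} {D₁ : Ctx → γ × α → Prop}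
    (hl : Comp D l) (hf : Comp D₁ (fun c (x : γ × α) => f c x.2 x.1))
    (h₁ : ∀ c a g, D c a → g ∈ l c a → D₁ c (g, a) := by intros; exact True.intro) :
    Comp D (fun c a => (l c a).all (f c a)) :=
  (any hl (f := fun c a g => !f c a g) hf.not h₁).not.congr fun c a _ => by
    simp [List.all_eq_not_any_not]

theorem reverse {l : Ctx → α → List γ} (hl : Comp D l) : Comp D (fun c a => (l c a).reverse) := by
  have key : ∀ (l : List γ), l.foldl (fun s g => g :: s) [] = l.reverse := by
    intro l; simp
  refine (foldl (step := fun _ _ s g => g :: s) (s₀ := fun _ _ => [])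
    (D₁ := fun _ _ => True) hl (const _) (snd_id.fst.cons fst_id) (fun _ _ _ _ _ _ _ => trivial)
    fun Q => ?_).congr fun c a _ => (key _).symm
  obtain ⟨L, hL⟩ := hl.size_bound Q
  refine ⟨L, fun c hc a l₁ l₂ ha h => ?_⟩
  refine le_trans ?_ (hL c hc a ha)
  rw [key, esize_reverse, h]
  exact esize_le_of_sublist (List.sublist_append_left _ _)

theorem map {l : Ctx → α → List γ} {f : Ctx → α → γ → β} {D₁ : Ctx → γ × α → Prop}
    (hl : Comp D l) (hf : Comp D₁ (fun c (x : γ × α) => f c x.2 x.1))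
    (h₁ : ∀ c a g, D c a → g ∈ l c a → D₁ c (g, a) := by intros; exact True.intro) :
    Comp D (fun c a => (l c a).map (f c a)) := by
  have key : ∀ c a (l : List γ), l.foldl (fun s g => f c a g :: s) [] = (l.map (f c a)).reverse := by
    intro c a l
    have : ∀ (l : List γ) (s : List β),
        l.foldl (fun s g => f c a g :: s) s = (l.map (f c a)).reverse ++ s := by
      intro l
      induction l with
      | nil => simp
      | cons g l ih => intro s; simp [ih]
    simp [this]
  refine (foldl (step := fun c a s g => f c a g :: s) (s₀ := fun _ _ => [])
    (D₁ := fun c x => D₁ c x.2) hl (const _) (cons (hf.comp snd_id fun _ _ h => h) fst_id)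
    (fun c a l₁ g l₂ ha h => h₁ c a g ha (by simp [h]))
    fun Q => ?_).reverse.congr fun c a _ => by rw [key, List.reverse_reverse]
  obtain ⟨L, hL⟩ := hl.size_bound Q
  obtain ⟨F, hF⟩ := hf.size_bound Q
  -- At most `L` entries, each the image of a list element paired with the ambient datum.
  refine ⟨L * (F.comp (L + .X + 1) + 1) + 1, fun c hc a l₁ l₂ ha h => ?_⟩
  have hl₁ := hL c hc a ha
  rw [key, esize_reverse]
  simp only [Polynomial.eval_add, Polynomial.eval_mul, Polynomial.eval_comp, Polynomial.eval_X,
    Polynomial.eval_one]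
  refine esize_list_le ?_ ?_
  · have := length_lt_esize (l c a)
    simp only [h, List.length_append, List.length_map] at this hl₁ ⊢; omega
  · intro b hb
    obtain ⟨g, hg, rfl⟩ := List.mem_map.1 hb
    have hg : g ∈ l c a := by simp [h, hg]
    refine (hF c hc (g, a) (h₁ c a g ha hg)).trans (eval_mono F ?_)
    have := esize_le_of_mem hg
    simp only [esize_pair]; omega

theorem filter {l : Ctx → α → List γ} {f : Ctx → α → γ → Bool} {D₁ : Ctx → γ × α → Prop}
    (hl : Comp D l) (hf : Comp D₁ (fun c (x : γ × α) => f c x.2 x.1))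
    (h₁ : ∀ c a g, D c a → g ∈ l c a → D₁ c (g, a) := by intros; exact True.intro) :
    Comp D (fun c a => (l c a).filter (f c a)) := by
  have key : ∀ c a (l : List γ), l.foldl (fun s g => if f c a g then g :: s else s) [] =
      (l.filter (f c a)).reverse := by
    intro c a l
    have : ∀ (l : List γ) (s : List γ), l.foldl (fun s g => if f c a g then g :: s else s) s =
        (l.filter (f c a)).reverse ++ s := by
      intro l
      induction l with
      | nil => simp
      | cons g l ih => intro s; by_cases h : f c a g <;> simp [ih, h]
    simp [this]
  refine (foldl (step := fun c a s g => if f c a g then g :: s else s) (s₀ := fun _ _ => [])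
    (D₁ := fun c x => D₁ c x.2) hl (const _)
    (ite (b := fun c x => f c x.2.2 x.2.1) (hf.comp snd_id fun _ _ h => h)
      (cons snd_id.fst fst_id) fst_id)
    (fun c a l₁ g l₂ ha h => h₁ c a g ha (by simp [h]))
    fun Q => ?_).reverse.congr fun c a _ => by rw [key, List.reverse_reverse]
  obtain ⟨L, hL⟩ := hl.size_bound Q
  refine ⟨L, fun c hc a l₁ l₂ ha h => ?_⟩
  rw [key, esize_reverse]
  refine le_trans (esize_le_of_sublist (List.filter_sublist.trans ?_)) (hL c hc a ha)
  exact h ▸ List.sublist_append_left _ _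

theorem append {l l' : Ctx → α → List γ} (hl : Comp D l) (hl' : Comp D l') :
    Comp D (fun c a => l c a ++ l' c a) := by
  have key : ∀ (l s : List γ), l.foldl (fun s g => g :: s) s = l.reverse ++ s := by
    intro l s; simp
  refine (foldl (step := fun _ _ s g => g :: s)
    (D₁ := fun _ _ => True) hl.reverse hl' (snd_id.fst.cons fst_id)
    (fun _ _ _ _ _ _ _ => trivial) fun Q => ?_).congr fun c a _ => by
      rw [key, List.reverse_reverse]
  obtain ⟨L, hL⟩ := hl.size_bound Q
  obtain ⟨L', hL'⟩ := hl'.size_bound Q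
  refine ⟨L + L', fun c hc a l₁ l₂ ha h => ?_⟩
  have h₂ := hL c hc a ha
  have h₃ := hL' c hc a ha
  have h₄ := esize_append l₁.reverse (l' c a)
  have h₅ : esize l₁ ≤ esize (l c a) := by
    rw [← esize_reverse (l c a), h]
    exact esize_le_of_sublist (List.sublist_append_left _ _)
  rw [key, Polynomial.eval_add]
  rw [esize_reverse] at h₄
  omega

theorem flatten {l : Ctx → α → List (List γ)} (hl : Comp D l) :
    Comp D (fun c a => (l c a).flatten) := by
  have key : ∀ (l : List (List γ)), l.foldl (fun s g => s ++ g) [] = l.flatten := by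
    intro l
    have : ∀ (l : List (List γ)) (s : List γ), l.foldl (fun s g => s ++ g) s = s ++ l.flatten := by
      intro l
      induction l with
      | nil => simp
      | cons g l ih => intro s; simp [ih]
    simp [this]
  have hsize : ∀ (l : List (List γ)), esize l.flatten ≤ esize l := by
    intro l
    induction l with
    | nil => simp
    | cons g l ih =>
      have := esize_append g l.flatten
      simp only [List.flatten_cons, esize_cons]; omega
  refine (foldl (step := fun _ _ s g => s ++ g) (s₀ := fun _ _ => [])
    (D₁ := fun _ _ => True) hl (const _) (append fst_id snd_id.fst)
    (fun _ _ _ _ _ _ _ => trivial) fun Q => ?_).congr fun c a _ => (key _).symm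
  obtain ⟨L, hL⟩ := hl.size_bound Q
  refine ⟨L, fun c hc a l₁ l₂ ha h => ?_⟩
  rw [key]
  refine (hsize l₁).trans (le_trans ?_ (hL c hc a ha))
  rw [h]
  exact esize_le_of_sublist (List.sublist_append_left _ _)

theorem flatMap {l : Ctx → α → List γ} {f : Ctx → α → γ → List β} {D₁ : Ctx → γ × α → Prop}
    (hl : Comp D l) (hf : Comp D₁ (fun c (x : γ × α) => f c x.2 x.1))
    (h₁ : ∀ c a g, D c a → g ∈ l c a → D₁ c (g, a) := by intros; exact True.intro) :
    Comp D (fun c a => (l c a).flatMap (f c a)) :=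
  (map hl hf h₁).flatten.congr fun _ _ _ => by rw [List.flatMap_def]

theorem product {l : Ctx → α → List β} {l' : Ctx → α → List γ} (hl : Comp D l)
    (hl' : Comp D l') : Comp D (fun c a => l c a ×ˢ l' c a) := by
  have : Comp (fun _ _ => True) (fun _ (x : List β × List γ) =>
      x.1.flatMap fun b => x.2.map fun g => (b, g)) :=
    flatMap (D₁ := fun _ _ => True) fst_id
      (f := fun _ (x : List β × List γ) b => x.2.map fun g => (b, g))
      (map (D₁ := fun _ _ => True) snd_id.snd
        (f := fun _ (x : β × List β × List γ) g => (x.1, g)) (snd_id.fst.pair fst_id))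
  exact (app₂ (h := fun _ l l' => l.flatMap fun b => l'.map fun g => (b, g)) this hl hl').congr
    fun _ _ _ => rfl

theorem zip {l : Ctx → α → List β} {l' : Ctx → α → List γ} (hl : Comp D l)
    (hl' : Comp D l') : Comp D (fun c a => (l c a).zip (l' c a)) := by
  -- The fold runs over the first list; its state holds the unused part of the second list and the
  -- pairs found so far in reverse. Once the second list is exhausted the state no longer changes.
  let step : List γ × List (β × γ) → β → List γ × List (β × γ) := fun s b =>
    ConstrainedElection.listElim s (fun g t => (t, (b, g) :: s.2)) s.1
  have key : ∀ (l : List β) (l' : List γ) (s : List (β × γ)),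
      l.foldl step (l', s) = (l'.drop l.length, (l.zip l').reverse ++ s) := by
    intro l
    induction l with
    | nil => intro l' s; simp
    | cons b l ih =>
      intro l' s
      cases l' with
      | nil =>
        have := ih [] s
        simp only [List.foldl_cons]
        simpa [step] using this
      | cons g l' => simp [step, ih]
  have hzip : ∀ (l : List β) (l' : List γ), esize (l.zip l') ≤ esize l + esize l' := by
    intro l
    induction l with
    | nil => intro l'; simp
    | cons b l ih =>
      intro l'
      cases l' with
      | nil => simp
      | cons g l' =>
        have := ih l'
        simp only [List.zip_cons_cons, esize_cons, esize_pair]; omega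
  have : Comp (fun _ _ => True) (fun _ (x : List β × List γ) => x.1.foldl step (x.2, [])) := by
    refine foldl (step := fun _ _ s b => step s b) (D₁ := fun _ _ => True) fst_id
      (snd_id.pair (const _)) ?_ (fun _ _ _ _ _ _ _ => trivial)
      fun Q => ⟨2 * .X, fun c hc a l₁ l₂ _ h => ?_⟩
    · exact listElim (D₁ := fun _ _ => True) fst_id.fst fst_id
        (f := fun _ (x : (List γ × List (β × γ)) × β × List β × List γ) g t => (t, (x.2.1, g) :: x.1.2))
        (snd_id.fst.pair ((snd_id.snd.snd.fst.pair fst_id).cons snd_id.snd.fst.snd))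
    · obtain ⟨l, l'⟩ := a
      simp only at h
      have h₁ := hzip l₁ l'
      have h₂ : esize l₁ ≤ esize l := by
        rw [h]; exact esize_le_of_sublist (List.sublist_append_left _ _)
      have h₃ : esize (l'.drop l₁.length) ≤ esize l' := esize_le_of_sublist (List.drop_sublist _ _)
      simp only [key, esize_pair, List.append_nil, esize_reverse, Polynomial.eval_mul,
        Polynomial.eval_X, Polynomial.eval_ofNat]
      omega
  refine (app₂ (h := fun _ l l' => (l.foldl step (l', [])).2.reverse) this.snd.reverse
    hl hl').congr fun _ _ _ => ?_
  simp [key]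

end Comp

/-! ### Arithmetic -/

/-- Addition of a carry bit, on little endian binary representations. -/
def incStep (s : Bool × List Bool) (b : Bool) : Bool × List Bool :=
  (s.1 && b, (if s.1 then !b else b) :: s.2)

/-- Stated for an arbitrary carry and accumulator so that induction on the binary digits goes
through; a carry surviving to the end becomes a new leading digit. -/
theorem foldl_incStep (n : ℕ) (c : Bool) (acc : List Bool) :
    (if (n.bits.foldl incStep (c, acc)).1 then true :: (n.bits.foldl incStep (c, acc)).2
      else (n.bits.foldl incStep (c, acc)).2).reverse = acc.reverse ++ (n + c.toNat).bits := by
  induction n using Nat.binaryRec' generalizing c acc with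
  | zero => cases c <;> simp
  | bit b n hn ih =>
    rw [Nat.bits_append_bit n b hn, List.foldl_cons, incStep, ih]
    have h : Nat.bit b n + c.toNat = Nat.bit (if c then !b else b) (n + (c && b).toNat) := by
      cases b <;> cases c <;> (simp [Nat.bit_val]; try omega)
    rw [h, Nat.bits_append_bit]
    · simp
    -- No leading zero arises: if the higher part and its carry both vanish, then `b` is the leading
    -- one and `c` must be zero, so the new digit is one.
    · intro h0
      cases b <;> cases c <;> simp_all

/-- Comparison of little endian binary representations; the state consists of the remaining bits of
the second number and the result of the comparison so far. -/
def leStep (s : List Bool × Bool) (a : Bool) : List Bool × Bool :=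
  listElim ([], !a && s.2) (fun b t => (t, if a then b && s.2 else b || s.2)) s.1

/-- More significant digits override less significant ones, so the flag `f` matters only when the
two numbers processed here are equal. Missing digits of `m` count as zeros, while unread digits of
`m` at the end contain its leading one and force `n < m`. -/
theorem foldl_leStep (n m : ℕ) (f : Bool) :
    listElim (n.bits.foldl leStep (m.bits, f)).2 (fun _ _ => true)
      (n.bits.foldl leStep (m.bits, f)).1 = decide (n < m ∨ n = m ∧ f) := by
  induction n using Nat.binaryRec' generalizing m f with
  | zero =>
    induction m using Nat.binaryRec' with
    | zero => simp
    | bit b m hm _ =>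
      have : Nat.bit b m ≠ 0 := by
        rw [Nat.bit_ne_zero_iff]; exact hm
      simp [Nat.bits_append_bit m b hm, Nat.pos_of_ne_zero this]
  | bit a n hn ih =>
    rw [Nat.bits_append_bit n a hn, List.foldl_cons]
    induction m using Nat.binaryRec' with
    | zero =>
      have := ih 0 (!a && f)
      simp only [Nat.zero_bits] at this
      simp only [Nat.zero_bits, leStep, listElim_nil]
      rw [this]
      cases a <;> simp [Nat.bit_val]
    | bit b m hm _ =>
      rw [Nat.bits_append_bit m b hm]
      simp only [leStep, listElim_cons]
      rw [ih, decide_eq_decide]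
      cases a <;> cases b <;> cases f <;> simp [Nat.bit_val] <;> omega

/-- A linear bound is crude for binary numbers but enough for counters, which never exceed the
length of a list. -/
theorem esize_nat_le (n : ℕ) : esize n ≤ 4 * n + 1 := by
  have h : esize n.bits ≤ n.bits.length * (3 + 1) + 1 :=
    esize_list_le le_rfl fun b _ => esize_bool_le b
  have h₂ : n.bits.length ≤ n := by
    rw [Nat.size_eq_bits_len, Nat.size_le]
    exact Nat.lt_two_pow_self
  have h₃ : esize n = esize n.bits := rfl
  omega

namespace Comp
variable {α β γ δ σ : Type} [Enc α] [Enc β] [Enc γ] [Enc δ] [Enc σ]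
  {D D' : Ctx → α → Prop}

theorem bits {f : Ctx → α → ℕ} (hf : Comp D f) : Comp D (fun c a => (f c a).bits) :=
  hf.congr_enc fun _ _ _ => rfl

theorem succ {f : Ctx → α → ℕ} (hf : Comp D f) : Comp D (fun c a => f c a + 1) := by
  have hfold : Comp (fun _ _ => True)
      (fun _ (l : List Bool) => l.foldl incStep (true, [])) := by
    refine foldl (step := fun _ _ s b => incStep s b) (D₁ := fun _ _ => True) id' (const _)
      (((fst_id.fst).and snd_id.fst).pair
        (cons (ite (b := fun _ (x : (Bool × List Bool) × Bool × List Bool) => x.1.1) fst_id.fst snd_id.fst.not snd_id.fst) fst_id.snd))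
      (fun _ _ _ _ _ _ _ => trivial) fun Q => ⟨4 * .X + 5, fun c hc a l₁ l₂ _ h => ?_⟩
    have key : ∀ (l : List Bool) (s : Bool × List Bool),
        (l.foldl incStep s).2.length = l.length + s.2.length := by
      intro l
      induction l with
      | nil => simp
      | cons b l ih => intro s; simp only [List.foldl_cons, ih, incStep, List.length_cons]; omega
    have h₁ : esize (l₁.foldl incStep (true, [])).2 ≤ a.length * (3 + 1) + 1 :=
      esize_list_le (by rw [key, h]; simp) fun b _ => esize_bool_le b
    have h₂ := esize_bool_le (l₁.foldl incStep (true, [])).1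
    have h₃ := length_lt_esize a
    rw [← Prod.mk.eta (p := l₁.foldl incStep (true, [])), esize_pair]
    simp only [Polynomial.eval_add, Polynomial.eval_mul, Polynomial.eval_X, Polynomial.eval_ofNat]
    omega
  refine (app (g := fun _ (r : Bool × List Bool) => (if r.1 then true :: r.2 else r.2).reverse)
    (reverse (ite (b := fun _ r => r.1) fst_id (cons (const _) snd_id) snd_id))
    (hfold.app hf.bits)).congr_enc fun c a _ => ?_
  have := foldl_incStep (f c a) true []
  rw [this]
  rfl

theorem natLe {f g : Ctx → α → ℕ} (hf : Comp D f) (hg : Comp D g) :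
    Comp D (fun c a => decide (f c a ≤ g c a)) := by
  have hfold : Comp (fun _ _ => True)
      (fun _ (x : List Bool × List Bool) => x.1.foldl leStep (x.2, true)) := by
    have key : ∀ (l : List Bool) (s : List Bool × Bool),
        (l.foldl leStep s).1.length ≤ s.1.length := by
      intro l
      induction l with
      | nil => simp
      | cons b l ih =>
        intro s
        refine (ih _).trans ?_
        rcases s with ⟨_ | _, _⟩ <;> simp [leStep]
    refine foldl (step := fun _ _ s b => leStep s b) (D₁ := fun _ _ => True) fst_id
      (snd_id.pair (const _)) ?_
      (fun _ _ _ _ _ _ _ => trivial) fun Q => ⟨4 * .X + 5, fun c hc a l₁ l₂ _ h => ?_⟩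
    · exact listElim (D₁ := fun _ _ => True)
        (f := fun _ (x : (List Bool × Bool) × Bool × List Bool × List Bool) b t =>
          (t, if x.2.1 then b && x.1.2 else b || x.1.2)) fst_id.fst
        ((const _).pair (snd_id.fst.not.and fst_id.snd))
        (snd_id.fst.pair (ite (b := fun _ (x : Bool × List Bool × (List Bool × Bool) × Bool × List Bool × List Bool) =>
            x.2.2.2.1) snd_id.snd.snd.fst
          (fst_id.and snd_id.snd.fst.snd) (fst_id.or snd_id.snd.fst.snd)))
    · have h₁ : esize (l₁.foldl leStep (a.2, true)).1 ≤ a.2.length * (3 + 1) + 1 :=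
        esize_list_le (key _ _) fun b _ => esize_bool_le b
      have h₂ := esize_bool_le (l₁.foldl leStep (a.2, true)).2
      have h₃ := length_lt_esize a.2
      have h₄ : esize a = esize a.1 + esize a.2 + 1 := rfl
      rw [← Prod.mk.eta (p := l₁.foldl leStep (a.2, true)), esize_pair]
      simp only [Polynomial.eval_add, Polynomial.eval_mul, Polynomial.eval_X,
        Polynomial.eval_ofNat]
      omega
  refine (app (g := fun _ (r : List Bool × Bool) =>
      ConstrainedElection.listElim r.2 (fun _ _ => true) r.1)
    (listElim (D₁ := fun _ _ => True) fst_id snd_id (const _))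
    (app₂ (h := fun _ l l' => l.foldl leStep (l', true)) hfold hf.bits hg.bits)).congr
    fun c a _ => ?_
  rw [foldl_leStep]
  simp [le_iff_lt_or_eq]

theorem natEq {f g : Ctx → α → ℕ} (hf : Comp D f) (hg : Comp D g) :
    Comp D (fun c a => decide (f c a = g c a)) :=
  ((hf.natLe hg).and (hg.natLe hf)).congr fun c a _ => by
    rw [← Bool.decide_and]; simp [le_antisymm_iff]

theorem length {l : Ctx → α → List γ} (hl : Comp D l) : Comp D (fun c a => (l c a).length) := by
  have key : ∀ (l : List γ) (n : ℕ), l.foldl (fun n _ => n + 1) n = n + l.length := by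
    intro l
    induction l with
    | nil => simp
    | cons g l ih => intro n; simp only [List.foldl_cons, ih, List.length_cons]; omega
  refine (app (g := fun _ l => l.foldl (fun n _ => n + 1) 0)
    (foldl (step := fun _ _ n _ => n + 1) (D₁ := fun _ _ => True) id' (const _)
      fst_id.succ (fun _ _ _ _ _ _ _ => trivial)
      fun Q => ⟨4 * .X + 1, fun c hc a l₁ l₂ _ h => ?_⟩) hl).congr fun c a _ => by simp [key]
  have h₁ := esize_nat_le (l₁.foldl (fun n _ => n + 1) 0)
  have h₂ := length_lt_esize a
  rw [key] at h₁ ⊢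
  rw [h, List.length_append] at h₂
  rw [h]
  simp only [Polynomial.eval_add, Polynomial.eval_mul, Polynomial.eval_X,
    Polynomial.eval_ofNat, Polynomial.eval_one]
  omega

theorem zipIdx {l : Ctx → α → List γ} (hl : Comp D l) : Comp D (fun c a => (l c a).zipIdx) := by
  have key : ∀ (l : List γ) (n : ℕ) (r : List (γ × ℕ)),
      l.foldl (fun s g => (s.1 + 1, (g, s.1) :: s.2)) (n, r) =
        (n + l.length, (l.zipIdx n).reverse ++ r) := by
    intro l
    induction l with
    | nil => simp
    | cons g l ih => intro n r; simp [ih]; omega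
  have hsize : ∀ (l : List γ) (n N : ℕ), n + l.length ≤ N →
      esize (l.zipIdx n) ≤ esize l + l.length * (4 * N + 2) := by
    intro l
    induction l with
    | nil => simp
    | cons g l ih =>
      intro n N h
      rw [List.length_cons] at h
      have := ih (n + 1) N (by omega)
      have h₂ := esize_nat_le n
      simp only [List.zipIdx_cons, esize_cons, esize_pair, List.length_cons, add_mul]; omega
  refine (app (g := fun _ l => (l.foldl (fun s g => (s.1 + 1, (g, s.1) :: s.2))
      ((0, []) : ℕ × List (γ × ℕ))).2.reverse)
    (reverse (snd (foldl (step := fun _ _ s g => (s.1 + 1, (g, s.1) :: s.2))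
      (D₁ := fun _ _ => True) id' (const _)
      (fst_id.fst.succ.pair (cons (snd_id.fst.pair fst_id.fst) fst_id.snd))
      (fun _ _ _ _ _ _ _ => trivial)
      fun Q => ⟨.X + .X * (4 * .X + 2) + 4 * .X + 2, fun c hc a l₁ l₂ _ h => ?_⟩))) hl).congr
      fun c a _ => by simp [key]
  have h₁ := hsize l₁ 0 (esize a)
  have h₂ := length_lt_esize a
  have h₃ : l₁.length ≤ esize a := by
    rw [h, List.length_append] at h₂; rw [h]; omega
  have h₄ := esize_nat_le l₁.length
  have h₅ : esize l₁ ≤ esize a := by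
    rw [h]; exact esize_le_of_sublist (List.sublist_append_left _ _)
  have h₆ : l₁.length * (4 * esize a + 2) ≤ esize a * (4 * esize a + 2) := by gcongr
  rw [key]
  simp only [esize_pair, zero_add, List.append_nil, esize_reverse, Polynomial.eval_add,
    Polynomial.eval_mul, Polynomial.eval_X, Polynomial.eval_ofNat]
  omega

end Comp

/-! ### The algorithm -/

/-- Characteristic vectors of sets of candidates. -/
abbrev Vec := List Bool

def ones (v : Vec) : ℕ := (v.filter fun b => b).length

def vand (v w : Vec) : Vec := (v.zip w).map fun x => x.1 && x.2

def vor (v w : Vec) : Vec := (v.zip w).map fun x => x.1 || x.2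

/-- Number of members of `v` with label `l`. -/
def meet (l v : Vec) : ℕ := ones (vand l v)

/-- `v` and `w` have the same size and the same number of members with label `l`. -/
def sameSig (l v w : Vec) : Bool := decide (meet l v = meet l w) && decide (ones v = ones w)

/-- Insertion of `v` into a table that has at most one entry of each signature. -/
def ins (orc : Vec → Vec → Bool) (l : Vec) (T : List Vec) (v : Vec) : List Vec :=
  if T.any fun w => sameSig l w v && orc w v then T else v :: T.filter fun w => !sameSig l w v

/-- Keeps one best entry of each signature. -/
def prune (orc : Vec → Vec → Bool) (l : Vec) (L : List Vec) : List Vec := L.foldl (ins orc l) []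

def joins (T T' : List Vec) : List Vec := T.flatMap fun v => T'.map fun w => vor v w

def singleVec (cands : List ℕ) (i : ℕ) : Vec := cands.map fun j => decide (j = i)

def zeroVec (cands : List ℕ) : Vec := cands.map fun _ => false

/-- Best subsets of the label `l`, of each size. -/
def table (orc : Vec → Vec → Bool) (cands : List ℕ) (l : Vec) : List Vec :=
  cands.foldl (fun T i => if decide (meet l (singleVec cands i) = 0) then T else
    prune orc l (joins T [zeroVec cands, singleVec cands i])) [zeroVec cands]

/-- Constraints, with labels given by their numbers. -/
abbrev RawConstraint := (ℕ × ℕ × ℕ) ⊕ (ℕ × ℕ)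

/-- `n` members with label `i` are permitted by the interval constraints. -/
def intervalsOK (cs : List RawConstraint) (i n : ℕ) : Bool :=
  cs.all fun c => Sum.elim
    (fun t => !decide (t.2.2 = i) || (decide (t.1 ≤ n) && decide (n ≤ t.2.1))) (fun _ => true) c

def has (P : List (ℕ × ℕ)) (x y : ℕ) : Bool := P.any fun z => decide (z.1 = x) && decide (z.2 = y)

/-- The pairs in `V` that are in the transitive relation generated by `P` and the pair `e`. -/
def addEdge (V P : List (ℕ × ℕ)) (e : ℕ × ℕ) : List (ℕ × ℕ) :=
  V.filter fun x => has P x.1 x.2 || (has P x.1 e.1 && has P e.2 x.2)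

def reachStep (V P : List (ℕ × ℕ)) (c : RawConstraint) : List (ℕ × ℕ) :=
  Sum.elim (fun _ => P) (fun e => addEdge V P e) c

/-- The pairs in `V` that are in the reflexive transitive closure of the dominance constraints. -/
def reach (V : List (ℕ × ℕ)) (cs : List RawConstraint) : List (ℕ × ℕ) :=
  cs.foldl (reachStep V) (V.filter fun x => decide (x.1 = x.2))

/-- The number of a label, the label, and a table of subsets of its component. -/
abbrev Node := ℕ × Vec × List Vec

/-- All relations of `v` to other nodes in `live` factor through `u`. -/
def mergeable (P : List (ℕ × ℕ)) (live : List Node) (u v : Node) : Bool :=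
  !decide (u.1 = v.1) && live.all fun w => decide (w.1 = u.1) || (decide (w.1 = v.1) ||
    ((!has P w.1 v.1 || (has P w.1 u.1 && has P u.1 v.1)) &&
      (!has P v.1 w.1 || (has P v.1 u.1 && has P u.1 w.1))))

def respects (P : List (ℕ × ℕ)) (u v : Node) (z : Vec) : Bool :=
  (!has P u.1 v.1 || decide (meet v.2.1 z ≤ meet u.2.1 z)) &&
    (!has P v.1 u.1 || decide (meet u.2.1 z ≤ meet v.2.1 z))

/-- The merged node keeps the number and label of `u`. For a mergeable pair, later dominance checks
never need the count of `v`, so pruning may identify entries that differ only there. -/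
def mergeNodes (orc : Vec → Vec → Bool) (P : List (ℕ × ℕ)) (u v : Node) : Node :=
  (u.1, u.2.1, prune orc u.2.1 ((joins u.2.2 v.2.2).filter (respects P u v)))

/-- One mergeable pair per round, with mergeability re-evaluated on the remaining nodes, since every
merge removes relations that could have blocked other pairs. -/
def mergeRound (orc : Vec → Vec → Bool) (P : List (ℕ × ℕ)) (live : List Node) : List Node :=
  listElim live (fun e _ => mergeNodes orc P e.1 e.2 ::
      live.filter fun w => !decide (w.1 = e.1.1) && !decide (w.1 = e.2.1))
    ((live ×ˢ live).filter fun e => mergeable P live e.1 e.2)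

/-- Encoded inputs. -/
abbrev Raw := (List ℕ × List (List ℕ)) × ℕ × List Vec × List RawConstraint

namespace Raw

/-- The labels, and the set of the candidates without a label. -/
def allLabels (r : Raw) : List Vec :=
  r.2.2.1 ++ [r.1.1.map fun i => !r.2.2.1.any fun l => !decide (meet l (singleVec r.1.1 i) = 0)]

def pairs (r : Raw) : List (ℕ × ℕ) :=
  (r.allLabels.zipIdx.map fun x => x.2) ×ˢ (r.allLabels.zipIdx.map fun x => x.2)

def reach (r : Raw) : List (ℕ × ℕ) := ConstrainedElection.reach r.pairs r.2.2.2

def nodes (orc : Vec → Vec → Bool) (r : Raw) : List Node :=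
  r.allLabels.zipIdx.map fun x => (x.2, x.1,
    (table orc r.1.1 x.1).filter fun v => intervalsOK r.2.2.2 x.2 (ones v))

/-- A best committee of size `k` from a table. -/
def select (orc : Vec → Vec → Bool) (r : Raw) (T : List Vec) : Option Vec :=
  listElim none (fun v _ => some v) (prune orc [] (T.filter fun v => decide (ones v = r.2.1)))

/-- The initial list of nodes also serves as the loop counter: as many rounds as nodes are enough to
get down to one. -/
def solve (orc : Vec → Vec → Bool) (r : Raw) : Option Vec :=
  listElim none (fun u _ => r.select orc u.2.2)
    ((r.nodes orc).foldl (fun live _ => mergeRound orc r.reach live) (r.nodes orc))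

end Raw

/-! ### Encoding -/

def vec {m : ℕ} (X : Finset (Fin m)) : Vec := List.ofFn fun c => decide (c ∈ X)

/-- Positions beyond the end of `v` read as `false`, so that every vector denotes a set; this
inverts `vec` on vectors of length `m`. -/
def toSet (m : ℕ) (v : Vec) : Finset (Fin m) := Finset.univ.filter fun c => v.getD c false = true

section Vec
variable {m : ℕ}

@[simp] theorem length_vec (X : Finset (Fin m)) : (vec X).length = m := by simp [vec]

@[simp] theorem enc_vec (X : Finset (Fin m)) : enc (vec X) = Data.ofFinset X := by
  simp only [enc, vec, Data.ofFinset, List.map_ofFn]; rfl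

@[simp] theorem toSet_vec (X : Finset (Fin m)) : toSet m (vec X) = X := by
  ext c
  simp [toSet, vec]

theorem vec_toSet {v : Vec} (h : v.length = m) : vec (toSet m v) = v := by
  apply List.ext_getElem
  · simp [h]
  · intro i h₁ h₂
    simp [vec, toSet, h₂]

theorem vec_injective : Function.Injective (vec (m := m)) :=
  Function.LeftInverse.injective toSet_vec

@[simp] theorem vand_vec (X Y : Finset (Fin m)) : vand (vec X) (vec Y) = vec (X ∩ Y) := by
  apply List.ext_getElem
  · simp [vand]
  · intro i h₁ h₂
    simp [vec, vand]

@[simp] theorem vor_vec (X Y : Finset (Fin m)) : vor (vec X) (vec Y) = vec (X ∪ Y) := by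
  apply List.ext_getElem
  · simp [vor]
  · intro i h₁ h₂
    simp [vec, vor]

@[simp] theorem ones_vec (X : Finset (Fin m)) : ones (vec X) = X.card := by
  rw [ones, vec, List.ofFn_eq_map, List.filter_map, List.length_map,
    ← List.toFinset_card_of_nodup ((List.nodup_finRange m).filter _)]
  congr 1
  ext c
  simp

theorem meet_vec (X Y : Finset (Fin m)) : meet (vec X) (vec Y) = (Y ∩ X).card := by
  rw [meet, vand_vec, ones_vec, Finset.inter_comm]

/-- The numbers of the candidates. -/
def candList (m : ℕ) : List ℕ := List.ofFn fun c : Fin m => (c : ℕ)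

theorem singleVec_candList (c : Fin m) : singleVec (candList m) c = vec {c} := by
  simp [singleVec, candList, vec, List.map_ofFn, Function.comp_def, Fin.ext_iff]

theorem zeroVec_candList : zeroVec (candList m) = vec (∅ : Finset (Fin m)) := by
  simp [zeroVec, candList, vec, List.map_ofFn, Function.comp_def]

end Vec

def Constraint.raw {l : ℕ} : Constraint l → RawConstraint
  | .interval p q i => .inl (p, q, (i : ℕ))
  | .dominance i j => .inr ((i : ℕ), (j : ℕ))

/-- A version of the input without dependent types whose encoding is literally `I.encode`, so that
the algorithm can be written on plain lists and numbers. -/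
def Input.raw (I : Input) : Raw :=
  ((candList I.election.m, I.election.voters.map fun σ => List.ofFn fun i => (σ i : ℕ)), I.k,
    (List.ofFn fun i => vec (I.label i)), I.constraints.map Constraint.raw)

theorem enc_constraint_raw {l : ℕ} (c : Constraint l) : enc c.raw = c.encode := by
  cases c <;> rfl

theorem enc_input_raw (I : Input) : enc I.raw = I.encode := by
  have h₁ : enc (candList I.election.m) =
      Data.ofList (List.ofFn fun c : Fin I.election.m => Data.ofNat c) := by
    change Data.ofList (List.map _ _) = _
    rw [candList, List.map_ofFn]; rfl
  have h₂ : enc (I.election.voters.map fun σ => List.ofFn fun i => (σ i : ℕ)) =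
      Data.ofList (I.election.voters.map fun σ =>
        Data.ofList (List.ofFn fun i => Data.ofNat (σ i))) := by
    change Data.ofList (List.map _ _) = _
    rw [List.map_map]
    congr 2
    funext σ
    change Data.ofList (List.map _ _) = _
    rw [List.map_ofFn]; rfl
  have h₃ : enc (List.ofFn fun i => vec (I.label i)) =
      Data.ofList (List.ofFn fun i => Data.ofFinset (I.label i)) := by
    change Data.ofList (List.map _ _) = _
    rw [List.map_ofFn]
    congr 2
    funext i
    exact enc_vec _
  have h₄ : enc (I.constraints.map Constraint.raw) =
      Data.ofList (I.constraints.map Constraint.encode) := by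
    change Data.ofList (List.map _ _) = _
    rw [List.map_map]
    congr 2
    funext i
    exact enc_constraint_raw _
  change Data.cons (.cons (enc _) (enc _)) (.cons (enc _) (.cons (enc _) (enc _))) = _
  simp only [Input.raw]
  rw [h₁, h₂, h₃, h₄]; rfl

open Classical in
/-- The order over committees, as a test on characteristic vectors. -/
noncomputable def vecOrder {m : ℕ} (ge : Finset (Fin m) → Finset (Fin m) → Prop) (v w : Vec) : Bool :=
  decide (ge (toSet m v) (toSet m w))

/-! ### Running time of the algorithm -/

namespace Ctx

def m (c : Ctx) : ℕ := c.I.election.m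

noncomputable def orc (c : Ctx) : Vec → Vec → Bool := vecOrder c.ge

end Ctx

namespace Comp
variable {α : Type} [Enc α] {D : Ctx → α → Prop}

theorem ones {v : Ctx → α → Vec} (hv : Comp D v) : Comp D (fun c a => ones (v c a)) :=
  length (filter (D₁ := fun _ _ => True) hv fst_id)

theorem vand {v w : Ctx → α → Vec} (hv : Comp D v) (hw : Comp D w) :
    Comp D (fun c a => vand (v c a) (w c a)) :=
  map (D₁ := fun _ _ => True) (hv.zip hw) (f := fun _ _ (x : Bool × Bool) => x.1 && x.2)
    (fst_id.fst.and fst_id.snd)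

theorem vor {v w : Ctx → α → Vec} (hv : Comp D v) (hw : Comp D w) :
    Comp D (fun c a => vor (v c a) (w c a)) :=
  map (D₁ := fun _ _ => True) (hv.zip hw) (f := fun _ _ (x : Bool × Bool) => x.1 || x.2)
    (fst_id.fst.or fst_id.snd)

theorem meet {v w : Ctx → α → Vec} (hv : Comp D v) (hw : Comp D w) :
    Comp D (fun c a => meet (v c a) (w c a)) := (hv.vand hw).ones

theorem sameSig {l v w : Ctx → α → Vec} (hl : Comp D l) (hv : Comp D v) (hw : Comp D w) :
    Comp D (fun c a => sameSig (l c a) (v c a) (w c a)) :=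
  ((hl.meet hv).natEq (hl.meet hw)).and (hv.ones.natEq hw.ones)

theorem joins {T T' : Ctx → α → List Vec} (hT : Comp D T) (hT' : Comp D T') :
    Comp D (fun c a => joins (T c a) (T' c a)) :=
  app₂ (h := fun _ T T' => ConstrainedElection.joins T T')
    (flatMap (D₁ := fun _ _ => True) fst_id
      (f := fun _ (x : List Vec × List Vec) v => x.2.map fun w => ConstrainedElection.vor v w)
      (map (D₁ := fun _ _ => True) snd_id.snd
        (f := fun _ (x : Vec × List Vec × List Vec) w => ConstrainedElection.vor x.1 w)
        (snd_id.fst.vor fst_id))) hT hT'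

theorem singleVec {l : Ctx → α → List ℕ} {i : Ctx → α → ℕ} (hl : Comp D l) (hi : Comp D i) :
    Comp D (fun c a => singleVec (l c a) (i c a)) :=
  app₂ (h := fun _ l i => ConstrainedElection.singleVec l i)
    (map (D₁ := fun _ _ => True) fst_id (f := fun _ (x : List ℕ × ℕ) j => decide (j = x.2))
      (fst_id.natEq snd_id.snd)) hl hi

theorem zeroVec {l : Ctx → α → List ℕ} (hl : Comp D l) : Comp D (fun c a => zeroVec (l c a)) :=
  map (D₁ := fun _ _ => True) hl (f := fun _ _ _ => false) (const _)

theorem intervalsOK {cs : Ctx → α → List RawConstraint} {i n : Ctx → α → ℕ} (hcs : Comp D cs)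
    (hi : Comp D i) (hn : Comp D n) : Comp D (fun c a => intervalsOK (cs c a) (i c a) (n c a)) := by
  have h : Comp (fun _ _ => True) (fun _ (x : List RawConstraint × ℕ × ℕ) =>
      ConstrainedElection.intervalsOK x.1 x.2.1 x.2.2) :=
    all (D₁ := fun _ _ => True) fst_id
      (f := fun _ (x : List RawConstraint × ℕ × ℕ) k => Sum.elim
        (fun t => !decide (t.2.2 = x.2.1) || (decide (t.1 ≤ x.2.2) && decide (x.2.2 ≤ t.2.1)))
        (fun _ => true) k)
      (sumElim (D₁ := fun _ _ => True) (D₂ := fun _ _ => True)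
        (f := fun _ (x : RawConstraint × List RawConstraint × ℕ × ℕ) t =>
          !decide (t.2.2 = x.2.2.1) || (decide (t.1 ≤ x.2.2.2) && decide (x.2.2.2 ≤ t.2.1)))
        (g := fun _ _ _ => true) fst_id
        ((fst_id.snd.snd.natEq snd_id.snd.snd.fst).not.or
          ((fst_id.fst.natLe snd_id.snd.snd.snd).and (snd_id.snd.snd.snd.natLe fst_id.snd.fst)))
        (const _))
  exact h.app (hcs.pair (hi.pair hn))

theorem has {P : Ctx → α → List (ℕ × ℕ)} {x y : Ctx → α → ℕ} (hP : Comp D P)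
    (hx : Comp D x) (hy : Comp D y) : Comp D (fun c a => has (P c a) (x c a) (y c a)) := by
  have h : Comp (fun _ _ => True) (fun _ (x : List (ℕ × ℕ) × ℕ × ℕ) =>
      ConstrainedElection.has x.1 x.2.1 x.2.2) :=
    any (D₁ := fun _ _ => True) fst_id
      (f := fun _ (x : List (ℕ × ℕ) × ℕ × ℕ) z => decide (z.1 = x.2.1) && decide (z.2 = x.2.2))
      ((fst_id.fst.natEq snd_id.snd.fst).and (fst_id.snd.natEq snd_id.snd.snd))
  exact h.app (hP.pair (hx.pair hy))

theorem addEdge {V P : Ctx → α → List (ℕ × ℕ)} {e : Ctx → α → ℕ × ℕ} (hV : Comp D V)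
    (hP : Comp D P) (he : Comp D e) : Comp D (fun c a => addEdge (V c a) (P c a) (e c a)) := by
  have hinner : Comp (fun _ _ => True) (fun _ (x : (ℕ × ℕ) × List (ℕ × ℕ) × List (ℕ × ℕ) × ℕ × ℕ) =>
      ConstrainedElection.has x.2.2.1 x.1.1 x.1.2 ||
        (ConstrainedElection.has x.2.2.1 x.1.1 x.2.2.2.1 &&
          ConstrainedElection.has x.2.2.1 x.2.2.2.2 x.1.2)) := by
    have hP : Comp (fun _ _ => True)
      (fun _ (x : (ℕ × ℕ) × List (ℕ × ℕ) × List (ℕ × ℕ) × ℕ × ℕ) => x.2.2.1) := snd_id.snd.fst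
    have hz : Comp (fun _ _ => True)
      (fun _ (x : (ℕ × ℕ) × List (ℕ × ℕ) × List (ℕ × ℕ) × ℕ × ℕ) => x.1) := fst_id
    have he : Comp (fun _ _ => True)
      (fun _ (x : (ℕ × ℕ) × List (ℕ × ℕ) × List (ℕ × ℕ) × ℕ × ℕ) => x.2.2.2) := snd_id.snd.snd
    exact (hP.has hz.fst hz.snd).or ((hP.has hz.fst he.fst).and (hP.has he.snd hz.snd))
  have h : Comp (fun _ _ => True) (fun _ (x : List (ℕ × ℕ) × List (ℕ × ℕ) × ℕ × ℕ) =>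
      ConstrainedElection.addEdge x.1 x.2.1 x.2.2) :=
    filter (D₁ := fun _ _ => True) fst_id
      (f := fun _ (x : List (ℕ × ℕ) × List (ℕ × ℕ) × ℕ × ℕ) (z : ℕ × ℕ) =>
        ConstrainedElection.has x.2.1 z.1 z.2 || (ConstrainedElection.has x.2.1 z.1 x.2.2.1 &&
          ConstrainedElection.has x.2.1 x.2.2.2 z.2)) hinner
  exact h.app (hV.pair (hP.pair he))

theorem reachStep : Comp (fun _ _ => True)
    (fun _ (x : List (ℕ × ℕ) × RawConstraint × List (ℕ × ℕ) × List RawConstraint) =>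
      reachStep x.2.2.1 x.1 x.2.1) := by
  have h := sumElim
    (α := List (ℕ × ℕ) × RawConstraint × List (ℕ × ℕ) × List RawConstraint)
    (D := fun _ _ => True) (D₁ := fun _ _ => True) (D₂ := fun _ _ => True)
    (s := fun _ x => x.2.1) (f := fun _ x _ => x.1)
    (g := fun _ x e => ConstrainedElection.addEdge x.2.2.1 x.1 e)
    snd_id.fst snd_id.fst (snd_id.snd.snd.fst.addEdge snd_id.fst fst_id)
  exact h

/-- The relation built so far is always a sublist of `V`, so the state of the fold never outgrows
the input. -/
theorem reach {V : Ctx → α → List (ℕ × ℕ)} {cs : Ctx → α → List RawConstraint} (hV : Comp D V)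
    (hcs : Comp D cs) : Comp D (fun c a => reach (V c a) (cs c a)) := by
  refine app₂ (h := fun _ V cs => ConstrainedElection.reach V cs) ?_ hV hcs
  refine foldl_of_inv (σ := List (ℕ × ℕ)) (D₁ := fun _ _ => True) (fun _ x s => s.Sublist x.1)
    (l := fun _ (x : List (ℕ × ℕ) × List RawConstraint) => x.2)
    (s₀ := fun _ (x : List (ℕ × ℕ) × List RawConstraint) => x.1.filter fun x => decide (x.1 = x.2))
    (step := fun _ (x : List (ℕ × ℕ) × List RawConstraint) => ConstrainedElection.reachStep x.1)
    snd_id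
    (filter (D₁ := fun _ _ => True) fst_id (f := fun _ _ (x : ℕ × ℕ) => decide (x.1 = x.2))
      (fst_id.fst.natEq fst_id.snd)) reachStep (fun _ _ _ => List.filter_sublist) ?_ .X ?_
  · intro c x s g _ hs _
    refine ⟨trivial, ?_⟩
    cases g
    · exact hs
    · exact List.filter_sublist
  · intro c x s _ hs
    have := esize_le_of_sublist hs
    have h : esize x = esize x.1 + esize x.2 + 1 := rfl
    simp only [Polynomial.eval_X]; omega

theorem mergeable {P : Ctx → α → List (ℕ × ℕ)} {live : Ctx → α → List Node} {u v : Ctx → α → Node}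
    (hP : Comp D P) (hlive : Comp D live) (hu : Comp D u) (hv : Comp D v) :
    Comp D (fun c a => mergeable (P c a) (live c a) (u c a) (v c a)) := by
  have h : Comp (fun _ _ => True) (fun _ (x : List (ℕ × ℕ) × List Node × Node × Node) =>
      ConstrainedElection.mergeable x.1 x.2.1 x.2.2.1 x.2.2.2) := by
    refine (snd_id.snd.fst.fst.natEq snd_id.snd.snd.fst).not.and
      (all (D₁ := fun _ _ => True) snd_id.fst
        (f := fun _ (x : List (ℕ × ℕ) × List Node × Node × Node) w => decide (w.1 = x.2.2.1.1) ||
          (decide (w.1 = x.2.2.2.1) ||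
            ((!ConstrainedElection.has x.1 w.1 x.2.2.2.1 ||
              (ConstrainedElection.has x.1 w.1 x.2.2.1.1 &&
                ConstrainedElection.has x.1 x.2.2.1.1 x.2.2.2.1)) &&
            (!ConstrainedElection.has x.1 x.2.2.2.1 w.1 ||
              (ConstrainedElection.has x.1 x.2.2.2.1 x.2.2.1.1 &&
                ConstrainedElection.has x.1 x.2.2.1.1 w.1))))) ?_)
    have hP : Comp (fun _ _ => True)
      (fun _ (x : Node × List (ℕ × ℕ) × List Node × Node × Node) => x.2.1) := snd_id.fst
    have hw : Comp (fun _ _ => True)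
      (fun _ (x : Node × List (ℕ × ℕ) × List Node × Node × Node) => x.1.1) := fst_id.fst
    have hu : Comp (fun _ _ => True)
      (fun _ (x : Node × List (ℕ × ℕ) × List Node × Node × Node) => x.2.2.2.1.1) :=
      snd_id.snd.snd.fst.fst
    have hv : Comp (fun _ _ => True)
      (fun _ (x : Node × List (ℕ × ℕ) × List Node × Node × Node) => x.2.2.2.2.1) :=
      snd_id.snd.snd.snd.fst
    exact (hw.natEq hu).or ((hw.natEq hv).or
      (((hP.has hw hv).not.or ((hP.has hw hu).and (hP.has hu hv))).and
        ((hP.has hv hw).not.or ((hP.has hv hu).and (hP.has hu hw)))))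
  exact h.app (hP.pair (hlive.pair (hu.pair hv)))

theorem respects {P : Ctx → α → List (ℕ × ℕ)} {u v : Ctx → α → Node} {z : Ctx → α → Vec}
    (hP : Comp D P) (hu : Comp D u) (hv : Comp D v) (hz : Comp D z) :
    Comp D (fun c a => respects (P c a) (u c a) (v c a) (z c a)) :=
  ((hP.has hu.fst hv.fst).not.or ((hv.snd.fst.meet hz).natLe (hu.snd.fst.meet hz))).and
    ((hP.has hv.fst hu.fst).not.or ((hu.snd.fst.meet hz).natLe (hv.snd.fst.meet hz)))

theorem allLabels {r : Ctx → α → Raw} (hr : Comp D r) : Comp D (fun c a => (r c a).allLabels) := by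
  refine app (g := fun _ r => Raw.allLabels r) ?_ hr
  exact snd_id.snd.fst.append (cons (map (D₁ := fun _ _ => True) fst_id.fst
    (f := fun _ (r : Raw) i =>
      !r.2.2.1.any fun l => !decide (ConstrainedElection.meet l
        (ConstrainedElection.singleVec r.1.1 i) = 0))
    (any (D₁ := fun _ _ => True) snd_id.snd.snd.fst
      (f := fun _ (x : ℕ × Raw) l => !decide (ConstrainedElection.meet l
        (ConstrainedElection.singleVec x.2.1.1 x.1) = 0))
      ((fst_id.meet (snd_id.snd.fst.fst.singleVec snd_id.fst)).natEq (const _)).not).not)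
    (const _))

theorem pairs {r : Ctx → α → Raw} (hr : Comp D r) : Comp D (fun c a => (r c a).pairs) := by
  have h : Comp D (fun c a => (r c a).allLabels.zipIdx.map fun x => x.2) :=
    map (D₁ := fun _ _ => True) hr.allLabels.zipIdx (f := fun _ _ x => x.2) fst_id.snd
  exact h.product h

theorem rawReach {r : Ctx → α → Raw} (hr : Comp D r) : Comp D (fun c a => (r c a).reach) :=
  hr.pairs.reach hr.snd.snd.snd

end Comp

/-! ### Size bounds for the tables -/

theorem mem_ins {orc : Vec → Vec → Bool} {l v w : Vec} {T : List Vec} (h : w ∈ ins orc l T v) :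
    w = v ∨ w ∈ T := by
  unfold ins at h
  split_ifs at h
  · exact .inr h
  · rcases List.mem_cons.1 h with h | h
    · exact .inl h
    · exact .inr (List.mem_of_mem_filter h)

theorem length_ins_le (orc : Vec → Vec → Bool) (l v : Vec) (T : List Vec) :
    (ins orc l T v).length ≤ T.length + 1 := by
  unfold ins
  split_ifs
  · omega
  · have := List.length_filter_le (fun w => !sameSig l w v) T
    simp only [List.length_cons]; omega

theorem sameSig_iff {l v w : Vec} : sameSig l v w = true ↔ meet l v = meet l w ∧ ones v = ones w := by
  simp [sameSig]

theorem pairwise_ins {orc : Vec → Vec → Bool} {l : Vec} (v : Vec) {T : List Vec}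
    (h : T.Pairwise fun w w' => ¬ sameSig l w w' = true) :
    (ins orc l T v).Pairwise fun w w' => ¬ sameSig l w w' = true := by
  unfold ins
  split_ifs
  · exact h
  · refine List.pairwise_cons.2 ⟨fun w hw hs => ?_, h.filter _⟩
    have := (List.mem_filter.1 hw).2
    rw [sameSig_iff] at hs
    rw [Bool.not_eq_true', ← Bool.not_eq_true, sameSig_iff] at this
    exact this ⟨hs.1.symm, hs.2.symm⟩

theorem foldl_ins_mem {orc : Vec → Vec → Bool} {l w : Vec} (L T : List Vec)
    (h : w ∈ L.foldl (ins orc l) T) : w ∈ T ∨ w ∈ L := by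
  induction L generalizing T with
  | nil => exact .inl h
  | cons v L ih =>
    rcases ih _ h with h | h
    · rcases mem_ins h with rfl | h
      · exact .inr List.mem_cons_self
      · exact .inl h
    · exact .inr (List.mem_cons_of_mem _ h)

theorem mem_prune {orc : Vec → Vec → Bool} {l w : Vec} {L : List Vec} (h : w ∈ prune orc l L) :
    w ∈ L := by
  simpa using foldl_ins_mem L [] h

theorem pairwise_prune (orc : Vec → Vec → Bool) (l : Vec) (L : List Vec) :
    (prune orc l L).Pairwise fun w w' => ¬ sameSig l w w' = true := by
  have : ∀ T : List Vec, T.Pairwise (fun w w' => ¬ sameSig l w w' = true) →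
      (L.foldl (ins orc l) T).Pairwise fun w w' => ¬ sameSig l w w' = true := by
    induction L with
    | nil => exact fun T h => h
    | cons v L ih => exact fun T h => ih _ (pairwise_ins v h)
  exact this [] List.Pairwise.nil

theorem ones_le_length (v : Vec) : ones v ≤ v.length := List.length_filter_le _ _

theorem meet_le_length (l v : Vec) : meet l v ≤ v.length := by
  refine (ones_le_length _).trans ?_
  simp [vand]

/-- Signatures are pairs of numbers in `{0, …, m}`, and distinct entries have distinct signatures.
This quadratic bound prevents repeated joins from growing exponentially. -/
theorem length_le_of_pairwise {l : Vec} {T : List Vec} {m : ℕ}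
    (h : T.Pairwise fun w w' => ¬ sameSig l w w' = true) (hm : ∀ v ∈ T, v.length = m) :
    T.length ≤ (m + 1) * (m + 1) := by
  have h₁ : (T.map fun v => (meet l v, ones v)).Nodup := by
    rw [List.Nodup, List.pairwise_map]
    refine h.imp fun hs he => hs (sameSig_iff.2 ?_)
    simpa using he
  rw [← List.length_map (fun v => (meet l v, ones v)), ← List.toFinset_card_of_nodup h₁]
  refine (Finset.card_le_card (t := Finset.range (m + 1) ×ˢ Finset.range (m + 1)) ?_).trans ?_
  · intro x hx
    simp only [List.mem_toFinset, List.mem_map] at hx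
    obtain ⟨v, hv, rfl⟩ := hx
    have h₂ := hm v hv
    have h₃ := ones_le_length v
    have h₄ := meet_le_length l v
    simp only [Finset.mem_product, Finset.mem_range]
    omega
  · simp

theorem length_prune_le {orc : Vec → Vec → Bool} {l : Vec} {L : List Vec} {m : ℕ}
    (hm : ∀ v ∈ L, v.length = m) : (prune orc l L).length ≤ (m + 1) * (m + 1) :=
  length_le_of_pairwise (pairwise_prune orc l L) fun v hv => hm v (mem_prune hv)

theorem length_of_mem_joins {T T' : List Vec} {m : ℕ} (h : ∀ v ∈ T, v.length = m)
    (h' : ∀ v ∈ T', v.length = m) {v : Vec} (hv : v ∈ joins T T') : v.length = m := by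
  simp only [joins, List.mem_flatMap, List.mem_map] at hv
  obtain ⟨x, hx, y, hy, rfl⟩ := hv
  simp [vor, h x hx, h' y hy]

/-- The tables of the algorithm for `m` candidates: not too long, and with entries of length `m`. -/
def TableOK (m : ℕ) (T : List Vec) : Prop :=
  (∀ v ∈ T, v.length = m) ∧ T.length ≤ (m + 1) * (m + 1)

theorem TableOK.filter {m : ℕ} {T : List Vec} (h : TableOK m T) (p : Vec → Bool) :
    TableOK m (T.filter p) :=
  ⟨fun v hv => h.1 v (List.mem_of_mem_filter hv), (List.length_filter_le _ _).trans h.2⟩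

theorem TableOK.esize_le {m : ℕ} {T : List Vec} (h : TableOK m T) :
    esize T ≤ (m + 1) * (m + 1) * (4 * m + 2) + 1 :=
  esize_list_le h.2 fun v hv => (esize_list_le (h.1 v hv).le fun b _ => esize_bool_le b).trans
    (by omega)

theorem tableOK_prune {orc : Vec → Vec → Bool} {l : Vec} {L : List Vec} {m : ℕ}
    (hm : ∀ v ∈ L, v.length = m) : TableOK m (prune orc l L) :=
  ⟨fun v hv => hm v (mem_prune hv), length_prune_le hm⟩

/-- One step of the computation of `table`. -/
def tableStep (orc : Vec → Vec → Bool) (cands : List ℕ) (l : Vec) (T : List Vec) (i : ℕ) :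
    List Vec :=
  if decide (meet l (singleVec cands i) = 0) then T else
    prune orc l (joins T [zeroVec cands, singleVec cands i])

theorem tableOK_tableStep {orc : Vec → Vec → Bool} {cands : List ℕ} {l : Vec} {T : List Vec} {i : ℕ}
    (h : TableOK cands.length T) : TableOK cands.length (tableStep orc cands l T i) := by
  unfold tableStep
  split_ifs
  · exact h
  · refine tableOK_prune fun v hv => length_of_mem_joins h.1 (fun w hw => ?_) hv
    simp only [List.mem_cons, List.not_mem_nil, or_false] at hw
    rcases hw with rfl | rfl <;> simp [zeroVec, singleVec]

theorem tableOK_zero (cands : List ℕ) : TableOK cands.length [zeroVec cands] :=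
  ⟨by simp [zeroVec], by simp only [List.length_cons, List.length_nil]; nlinarith⟩

theorem tableOK_table (orc : Vec → Vec → Bool) (cands : List ℕ) (l : Vec) :
    TableOK cands.length (table orc cands l) := by
  have : ∀ (is : List ℕ) (T : List Vec), TableOK cands.length T →
      TableOK cands.length (is.foldl (tableStep orc cands l) T) := by
    intro is
    induction is with
    | nil => exact fun T h => h
    | cons i is ih => exact fun T h => ih _ (tableOK_tableStep h)
  exact this cands _ (tableOK_zero cands)

@[simp] theorem length_candList (m : ℕ) : (candList m).length = m := by simp [candList]

/-! ### Subroutines that consult the order -/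

namespace Comp
variable {α : Type} [Enc α] {D : Ctx → α → Prop}

/-- The sole use of `call`. The routine is guaranteed to answer only on well-formed questions about
the given instance, which is why computability is stated relative to domains: the true input and
vectors of length `m` must be tracked through the whole algorithm. -/
theorem orc : Comp (fun c (x : Raw × Vec × Vec) =>
    x.1 = c.I.raw ∧ x.2.1.length = c.m ∧ x.2.2.length = c.m)
    (fun c x => c.orc x.2.1 x.2.2) := by
  refine ⟨.call, fun Q => ⟨Q, ?_⟩⟩
  rintro c rfl ⟨r, v, w⟩ ⟨hr, hv, hw⟩
  simp only at hr hv hw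
  obtain ⟨V, rfl⟩ : ∃ V : c.I.Committee, v = vec V := ⟨_, (vec_toSet hv).symm⟩
  obtain ⟨W, rfl⟩ : ∃ W : c.I.Committee, w = vec W := ⟨_, (vec_toSet hw).symm⟩
  have h : enc (r, vec V, vec W) = encodeQuery c.I V W := by
    change Data.cons (enc r) (.cons (enc (vec V)) (enc (vec W))) = _
    rw [hr, enc_input_raw, enc_vec, enc_vec]; rfl
  have h' : c.orc (vec V) (vec W) = true ↔ c.ge V W := by
    simp only [Ctx.orc, vecOrder, decide_eq_true_eq]
    rw [toSet_vec, toSet_vec]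
  simp only [esize]
  rw [h]
  by_cases hge : c.ge V W
  · rw [h'.2 hge]; exact (c.computes V W).1 hge
  · rw [Bool.eq_false_iff.2 (mt h'.1 hge)]; exact (c.computes V W).2 hge

theorem ins : Comp (fun c (x : Raw × Vec × List Vec × Vec) =>
    x.1 = c.I.raw ∧ (∀ w ∈ x.2.2.1, w.length = c.m) ∧ x.2.2.2.length = c.m)
    (fun c x => ins c.orc x.2.1 x.2.2.1 x.2.2.2) := by
  refine ite (b := fun c (x : Raw × Vec × List Vec × Vec) =>
      x.2.2.1.any fun w => ConstrainedElection.sameSig x.2.1 w x.2.2.2 && c.orc w x.2.2.2)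
    (any (D₁ := fun c (x : Vec × Raw × Vec × List Vec × Vec) =>
        x.2.1 = c.I.raw ∧ x.1.length = c.m ∧ x.2.2.2.2.length = c.m)
      (f := fun c (x : Raw × Vec × List Vec × Vec) w =>
        ConstrainedElection.sameSig x.2.1 w x.2.2.2 && c.orc w x.2.2.2)
      snd_id.snd.fst (.and (sameSig snd_id.snd.fst fst_id snd_id.snd.snd.snd) ?_)
      (fun c a g ha hg => ⟨ha.1, ha.2.1 g hg, ha.2.2⟩))
    snd_id.snd.fst
    (cons snd_id.snd.snd (filter (D₁ := fun _ _ => True) snd_id.snd.fst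
      (f := fun _ (x : Raw × Vec × List Vec × Vec) w =>
        !ConstrainedElection.sameSig x.2.1 w x.2.2.2)
      (sameSig snd_id.snd.fst fst_id snd_id.snd.snd.snd).not))
  exact orc.comp (f := fun _ (x : Vec × Raw × Vec × List Vec × Vec) => (x.2.1, x.1, x.2.2.2.2))
    (snd_id.fst.pair (fst_id.pair snd_id.snd.snd.snd)) fun c a ha => ha

theorem prune {r : Ctx → α → Raw} {l : Ctx → α → Vec} {L : Ctx → α → List Vec}
    (hr : Comp D r) (hl : Comp D l) (hL : Comp D L)
    (H : ∀ c a, D c a → r c a = c.I.raw ∧ ∀ w ∈ L c a, w.length = c.m) :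
    Comp D (fun c a => prune c.orc (l c a) (L c a)) := by
  have h : Comp (fun c (x : Raw × Vec × List Vec) => x.1 = c.I.raw ∧ ∀ w ∈ x.2.2, w.length = c.m)
      (fun c x => ConstrainedElection.prune c.orc x.2.1 x.2.2) := by
    -- Intermediate tables contain only vectors of the list being pruned; this yields both the
    -- length condition for the oracle and the size bound.
    have hmem : ∀ (c : Ctx) (l : Vec) (L L₁ L₂ : List Vec), L = L₁ ++ L₂ →
        ∀ w ∈ L₁.foldl (ConstrainedElection.ins c.orc l) [], w ∈ L := by
      intro c l L L₁ L₂ h w hw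
      have : w ∈ L₁ := mem_prune hw
      simp [h, this]
    refine foldl (step := fun c (x : Raw × Vec × List Vec) => ConstrainedElection.ins c.orc x.2.1)
      (s₀ := fun _ _ => []) (l := fun _ x => x.2.2)
      (D₁ := fun c x => x.2.2.1 = c.I.raw ∧ (∀ w ∈ x.1, w.length = c.m) ∧ x.2.1.length = c.m)
      snd_id.snd (const _) ?_ ?_ fun Q => ⟨.X * (.X + 1) + 1, ?_⟩
    · exact ins.comp (f := fun _ (x : List Vec × Vec × Raw × Vec × List Vec) =>
        (x.2.2.1, x.2.2.2.1, x.1, x.2.1))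
        (snd_id.snd.fst.pair (snd_id.snd.snd.fst.pair (fst_id.pair snd_id.fst))) fun c a ha => ha
    · intro c a L₁ g L₂ ha h
      exact ⟨ha.1, fun w hw => ha.2 w (hmem c _ _ _ _ h w hw), ha.2 g (by simp [h])⟩
    · intro c _ a L₁ L₂ ha h
      have hlen : ∀ (L T : List Vec), (L.foldl (ConstrainedElection.ins c.orc a.2.1) T).length ≤
          L.length + T.length := by
        intro L
        induction L with
        | nil => simp
        | cons v L ih =>
          intro T
          have := length_ins_le c.orc a.2.1 v T
          refine (ih _).trans ?_
          simp only [List.length_cons]; omega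
      have hsz : esize a.2.2 ≤ esize a := by
        have : esize a = esize a.1 + (esize a.2.1 + esize a.2.2 + 1) + 1 := rfl
        omega
      simp only [Polynomial.eval_add, Polynomial.eval_mul, Polynomial.eval_X, Polynomial.eval_one]
      refine esize_list_le ?_ fun w hw => (esize_le_of_mem (hmem c _ _ _ _ h w hw)).trans hsz
      have h₁ := hlen L₁ []
      have h₂ := length_lt_esize a.2.2
      rw [h, List.length_append, ← h] at h₂
      simp only [List.length_nil] at h₁
      omega
  exact h.comp (f := fun c a => (r c a, l c a, L c a)) (hr.pair (hl.pair hL)) H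

theorem table {r : Ctx → α → Raw} {l : Ctx → α → Vec} (hr : Comp D r) (hl : Comp D l)
    (H : ∀ c a, D c a → r c a = c.I.raw) :
    Comp D (fun c a => table c.orc (r c a).1.1 (l c a)) := by
  have h : Comp (fun c (x : Raw × Vec) => x.1 = c.I.raw)
      (fun c x => ConstrainedElection.table c.orc x.1.1.1 x.2) := by
    have hr : Comp (fun c (x : List Vec × ℕ × Raw × Vec) => x.2.2.1 = c.I.raw ∧
      ∀ v ∈ x.1, v.length = c.m) (fun _ x => x.2.2.1) := snd_id.snd.fst
    have hl : Comp (fun c (x : List Vec × ℕ × Raw × Vec) => x.2.2.1 = c.I.raw ∧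
      ∀ v ∈ x.1, v.length = c.m) (fun _ x => x.2.2.2) := snd_id.snd.snd
    have hi : Comp (fun c (x : List Vec × ℕ × Raw × Vec) => x.2.2.1 = c.I.raw ∧
      ∀ v ∈ x.1, v.length = c.m) (fun _ x => x.2.1) := snd_id.fst
    have hT : Comp (fun c (x : List Vec × ℕ × Raw × Vec) => x.2.2.1 = c.I.raw ∧
      ∀ v ∈ x.1, v.length = c.m) (fun _ x => x.1) := fst_id
    have hstep : Comp (fun c (x : List Vec × ℕ × Raw × Vec) => x.2.2.1 = c.I.raw ∧
        ∀ v ∈ x.1, v.length = c.m)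
        (fun c x => tableStep c.orc x.2.2.1.1.1 x.2.2.2 x.1 x.2.1) := by
      have hs := hr.fst.fst.singleVec hi
      have h := ite (b := fun _ x =>
          decide (ConstrainedElection.meet x.2.2.2
            (ConstrainedElection.singleVec x.2.2.1.1.1 x.2.1) = 0))
        ((hl.meet hs).natEq (const 0)) hT
        (prune hr hl (hT.joins (cons hr.fst.fst.zeroVec (cons hs (const [])))) ?_)
      · exact h
      · intro c x hx
        refine ⟨hx.1, fun w hw => length_of_mem_joins hx.2 (fun w hw => ?_) hw⟩
        simp only [List.mem_cons, List.not_mem_nil, or_false] at hw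
        rcases hw with rfl | rfl <;>
          simp [ConstrainedElection.zeroVec, ConstrainedElection.singleVec, hx.1, Input.raw, Ctx.m]
    refine foldl_of_inv (step := fun c (x : Raw × Vec) => tableStep c.orc x.1.1.1 x.2)
      (fun c x T => TableOK c.m T) fst_id.fst.fst (cons fst_id.fst.fst.zeroVec (const _)) hstep
      ?_ ?_ ((.X + 1) * (.X + 1) * (4 * .X + 2) + 1) ?_
    · intro c x hx
      have := tableOK_zero x.1.1.1
      simpa [hx, Input.raw, Ctx.m] using this
    · intro c x T i hx hT _
      refine ⟨⟨hx, hT.1⟩, ?_⟩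
      have := tableOK_tableStep (orc := c.orc) (cands := x.1.1.1) (l := x.2) (T := T) (i := i)
      have hm : x.1.1.1.length = c.m := by simp [hx, Input.raw, Ctx.m]
      rw [hm] at this
      exact this hT
    · intro c x T hx hT
      have hm : x.1.1.1.length = c.m := by simp [hx, Input.raw, Ctx.m]
      have h₁ : esize x = ((esize x.1.1.1 + esize x.1.1.2 + 1) + esize x.1.2 + 1) + esize x.2 + 1 :=
        rfl
      have h₂ := length_lt_esize x.1.1.1
      have h₃ : c.m ≤ esize x := by omega
      refine hT.esize_le.trans ?_
      simp only [Polynomial.eval_add, Polynomial.eval_mul, Polynomial.eval_X,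
        Polynomial.eval_ofNat, Polynomial.eval_one]
      gcongr
  exact h.comp (f := fun c a => (r c a, l c a)) (hr.pair hl) H

end Comp

/-! ### Size bounds and running time of the main loop -/

theorem mem_mergeable_pairs {P : List (ℕ × ℕ)} {live : List Node} {e : Node × Node}
    (h : e ∈ (live ×ˢ live).filter fun e => mergeable P live e.1 e.2) :
    e.1 ∈ live ∧ e.2 ∈ live ∧ mergeable P live e.1 e.2 = true := by
  rw [List.mem_filter, ← Prod.mk.eta (p := e), List.mem_product] at h
  exact ⟨h.1.1, h.1.2, h.2⟩

/-- Either nothing changes, or two mergeable nodes are merged. -/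
theorem mergeRound_cases (orc : Vec → Vec → Bool) (P : List (ℕ × ℕ)) (live : List Node) :
    (mergeRound orc P live = live ∧ ∀ u ∈ live, ∀ v ∈ live, ¬ mergeable P live u v = true) ∨
    ∃ u ∈ live, ∃ v ∈ live, mergeable P live u v = true ∧
      mergeRound orc P live = mergeNodes orc P u v ::
        live.filter fun w => !decide (w.1 = u.1) && !decide (w.1 = v.1) := by
  unfold mergeRound
  rcases h : (live ×ˢ live).filter fun e => mergeable P live e.1 e.2 with _ | ⟨e, t⟩
  · refine .inl ⟨by rw [h]; rfl, fun u hu v hv huv => ?_⟩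
    have : (u, v) ∈ (live ×ˢ live).filter fun e => mergeable P live e.1 e.2 :=
      List.mem_filter.2 ⟨List.mem_product.2 ⟨hu, hv⟩, huv⟩
    rw [h] at this
    exact List.not_mem_nil this
  · obtain ⟨h₁, h₂, h₃⟩ := mem_mergeable_pairs (h ▸ List.mem_cons_self)
    exact .inr ⟨_, h₁, _, h₂, h₃, by rw [h]; rfl⟩

theorem length_mergeRound_le (orc : Vec → Vec → Bool) (P : List (ℕ × ℕ)) (live : List Node) :
    (mergeRound orc P live).length ≤ live.length := by
  rcases mergeRound_cases orc P live with ⟨h, _⟩ | ⟨u, hu, v, _, _, h⟩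
  · rw [h]
  · rw [h, List.length_cons, Nat.succ_le_iff, List.length_filter_lt_length_iff_exists]
    exact ⟨u, hu, by simp⟩

/-- Invariant of the main loop that bounds the size of the tables. -/
def LiveOK (m : ℕ) (init live : List Node) : Prop :=
  live.length ≤ init.length ∧
    ∀ u ∈ live, TableOK m u.2.2 ∧ ∃ u' ∈ init, u'.1 = u.1 ∧ u'.2.1 = u.2.1

theorem LiveOK.mergeRound {m : ℕ} {init live : List Node} (h : LiveOK m init live)
    (orc : Vec → Vec → Bool) (P : List (ℕ × ℕ)) : LiveOK m init (mergeRound orc P live) := by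
  refine ⟨(length_mergeRound_le orc P live).trans h.1, fun w hw => ?_⟩
  rcases mergeRound_cases orc P live with ⟨h', _⟩ | ⟨u, hu, v, hv, _, h'⟩
  · exact h.2 w (h' ▸ hw)
  · rw [h', List.mem_cons] at hw
    rcases hw with rfl | hw
    · refine ⟨tableOK_prune fun z hz => ?_, (h.2 u hu).2⟩
      exact length_of_mem_joins (h.2 u hu).1.1 (h.2 v hv).1.1 (List.mem_of_mem_filter hz)
    · exact h.2 w (List.mem_of_mem_filter hw)

/-- Merging neither adds nodes nor creates new numbers or labels, so everything except the tables is
bounded by the initial nodes, and the tables are bounded by counting signatures. -/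
theorem LiveOK.esize_le {m : ℕ} {init live : List Node} (h : LiveOK m init live) :
    esize live ≤
      esize init * (esize init + ((m + 1) * (m + 1) * (4 * m + 2) + 1) + 2 + 1) + 1 := by
  refine esize_list_le (h.1.trans (length_lt_esize init).le) fun u hu => ?_
  obtain ⟨hT, u', hu', h₁, h₂⟩ := h.2 u hu
  have h₃ := esize_le_of_mem hu'
  have h₄ := hT.esize_le
  have h₅ : esize u' = esize u'.1 + (esize u'.2.1 + esize u'.2.2 + 1) + 1 := rfl
  have h₆ : esize u = esize u.1 + (esize u.2.1 + esize u.2.2 + 1) + 1 := rfl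
  rw [h₁, h₂] at h₅
  omega

theorem Input.length_cands (I : Input) : I.raw.1.1.length = I.election.m := by simp [Input.raw]

namespace Comp
variable {α : Type} [Enc α] {D : Ctx → α → Prop}

theorem mergeNodes {r : Ctx → α → Raw} {P : Ctx → α → List (ℕ × ℕ)} {u v : Ctx → α → Node}
    (hr : Comp D r) (hP : Comp D P) (hu : Comp D u) (hv : Comp D v)
    (H : ∀ c a, D c a → r c a = c.I.raw ∧ (∀ w ∈ (u c a).2.2, w.length = c.m) ∧
      ∀ w ∈ (v c a).2.2, w.length = c.m) :
    Comp D (fun c a => mergeNodes c.orc (P c a) (u c a) (v c a)) := by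
  refine hu.fst.pair (hu.snd.fst.pair (prune hr hu.snd.fst
    (filter (D₁ := fun c x => D c x.2) (hu.snd.snd.joins hv.snd.snd)
      (f := fun c a z => ConstrainedElection.respects (P c a) (u c a) (v c a) z)
      (respects (P := fun c (x : Vec × α) => P c x.2) (u := fun c (x : Vec × α) => u c x.2)
        (v := fun c (x : Vec × α) => v c x.2)
        (hP.comp snd_id fun _ _ h => h) (hu.comp snd_id fun _ _ h => h)
        (hv.comp snd_id fun _ _ h => h) fst_id)
      (fun c a g ha _ => ha)) ?_))
  intro c a ha
  obtain ⟨h₁, h₂, h₃⟩ := H c a ha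
  exact ⟨h₁, fun w hw => length_of_mem_joins h₂ h₃ (List.mem_of_mem_filter hw)⟩

/-- The argument has the shape of a fold step: the current nodes, an ignored list entry, and the
environment formed by the initial nodes and the input. -/
theorem mergeRound : Comp (fun c (x : List Node × Node × List Node × Raw) =>
    x.2.2.2 = c.I.raw ∧ ∀ u ∈ x.1, ∀ w ∈ u.2.2, w.length = c.m)
    (fun c x => mergeRound c.orc x.2.2.2.reach x.1) := by
  have hpairs : Comp (fun _ _ => True) (fun _ (x : List Node × Node × List Node × Raw) =>
      (x.1 ×ˢ x.1).filter fun e => ConstrainedElection.mergeable x.2.2.2.reach x.1 e.1 e.2) := by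
    have hl : Comp (fun _ _ => True)
        (fun _ (x : (Node × Node) × List Node × Node × List Node × Raw) => x.2.1) := snd_id.fst
    have hr : Comp (fun _ _ => True)
        (fun _ (x : (Node × Node) × List Node × Node × List Node × Raw) => x.2.2.2.2) :=
      snd_id.snd.snd.snd
    have he : Comp (fun _ _ => True)
        (fun _ (x : (Node × Node) × List Node × Node × List Node × Raw) => x.1) := fst_id
    exact filter (D₁ := fun _ _ => True) (fst_id.product fst_id)
      (f := fun _ (x : List Node × Node × List Node × Raw) (e : Node × Node) =>
        ConstrainedElection.mergeable x.2.2.2.reach x.1 e.1 e.2)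
      (hr.rawReach.mergeable hl he.fst he.snd)
  have hrest : Comp (fun _ _ => True) (fun _ (x : List Node × Node × Node) =>
      x.1.filter fun w => !decide (w.1 = x.2.1.1) && !decide (w.1 = x.2.2.1)) :=
    filter (D₁ := fun _ _ => True) fst_id
      (f := fun _ (x : List Node × Node × Node) (w : Node) =>
        !decide (w.1 = x.2.1.1) && !decide (w.1 = x.2.2.1))
      ((fst_id.fst.natEq snd_id.snd.fst.fst).not.and (fst_id.fst.natEq snd_id.snd.snd.fst).not)
  let D₁ : Ctx → (Node × Node) × List (Node × Node) × List Node × Node × List Node × Raw → Prop :=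
    fun c x => x.2.2.2.2.2 = c.I.raw ∧ (∀ w ∈ x.1.1.2.2, w.length = c.m) ∧
      ∀ w ∈ x.1.2.2.2, w.length = c.m
  have he : Comp D₁ (fun _ x => x.1) := fst_id
  have hr : Comp D₁ (fun _ x => x.2.2.2.2.2) := snd_id.snd.snd.snd.snd
  have hl : Comp D₁ (fun _ x => x.2.2.1) := snd_id.snd.fst
  have hnew := mergeNodes hr hr.rawReach he.fst he.snd fun _ _ h => h
  have hrest' := hrest.app (hl.pair (he.fst.pair he.snd))
  have h := listElim (hpairs.mono fun _ _ _ => trivial)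
    (fst_id (D := fun c (x : List Node × Node × List Node × Raw) =>
    x.2.2.2 = c.I.raw ∧ ∀ u ∈ x.1, ∀ w ∈ u.2.2, w.length = c.m)) (D₁ := D₁)
    (f := fun c x e _ => ConstrainedElection.mergeNodes c.orc x.2.2.2.reach e.1 e.2 ::
      x.1.filter fun w => !decide (w.1 = e.1.1) && !decide (w.1 = e.2.1)) (hnew.cons hrest') ?_
  · exact h
  · intro c a e t ha h
    obtain ⟨h₁, h₂, _⟩ := mem_mergeable_pairs (h ▸ List.mem_cons_self)
    exact ⟨ha.1, ha.2 _ h₁, ha.2 _ h₂⟩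

/-- The main loop. -/
theorem mergeAll : Comp (fun c (x : List Node × Raw) =>
    x.2 = c.I.raw ∧ ∀ u ∈ x.1, TableOK c.m u.2.2)
    (fun c x => x.1.foldl (fun live _ => ConstrainedElection.mergeRound c.orc x.2.reach live)
      x.1) := by
  refine foldl_of_inv
    (step := fun c (x : List Node × Raw) live _ =>
      ConstrainedElection.mergeRound c.orc x.2.reach live)
    (fun c x live => LiveOK c.m x.1 live) fst_id fst_id mergeRound ?_ ?_
    (.X * (.X + ((.X + 1) * (.X + 1) * (4 * .X + 2) + 1) + 2 + 1) + 1) ?_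
  · exact fun c x hx => ⟨le_rfl, fun u hu => ⟨hx.2 u hu, u, hu, rfl, rfl⟩⟩
  · exact fun c x live _ hx h _ => ⟨⟨hx.1, fun u hu => (h.2 u hu).1.1⟩, h.mergeRound _ _⟩
  · intro c x live hx h
    have h₁ : esize x = esize x.1 + (((esize x.2.1.1 + esize x.2.1.2 + 1) + esize x.2.2 + 1)) + 1 :=
      rfl
    have h₂ := length_lt_esize x.2.1.1
    have h₃ : x.2.1.1.length = c.m := by rw [hx.1]; exact c.I.length_cands
    have h₄ : c.m ≤ esize x := by omega
    have h₅ : esize x.1 ≤ esize x := by omega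
    refine h.esize_le.trans ?_
    simp only [Polynomial.eval_add, Polynomial.eval_mul, Polynomial.eval_X,
      Polynomial.eval_ofNat, Polynomial.eval_one]
    gcongr

theorem nodes : Comp (fun c r => r = c.I.raw) (fun c r => r.nodes c.orc) := by
  have hr : Comp (fun c (x : (Vec × ℕ) × Raw) => x.2 = c.I.raw) (fun _ x => x.2) := snd_id
  have hx : Comp (fun c (x : (Vec × ℕ) × Raw) => x.2 = c.I.raw) (fun _ x => x.1) := fst_id
  have hok : Comp (fun _ _ => True) (fun _ (x : Vec × (Vec × ℕ) × Raw) =>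
      ConstrainedElection.intervalsOK x.2.2.2.2.2 x.2.1.2 (ConstrainedElection.ones x.1)) :=
    snd_id.snd.snd.snd.snd.intervalsOK snd_id.fst.snd fst_id.ones
  exact map (D := fun c r => r = c.I.raw) (D₁ := fun c (x : (Vec × ℕ) × Raw) => x.2 = c.I.raw) id'.allLabels.zipIdx
    (f := fun c (r : Raw) x => (x.2, x.1, (ConstrainedElection.table c.orc r.1.1 x.1).filter
      fun v => ConstrainedElection.intervalsOK r.2.2.2 x.2 (ConstrainedElection.ones v)))
    (hx.snd.pair (hx.fst.pair (filter (D₁ := fun _ _ => True) (table hr hx.fst fun _ _ h => h)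
      (f := fun _ (x : (Vec × ℕ) × Raw) v => ConstrainedElection.intervalsOK x.2.2.2.2 x.1.2
        (ConstrainedElection.ones v)) hok))) fun c a g ha _ => ha

theorem select : Comp (fun c (x : Raw × List Vec) => x.1 = c.I.raw ∧ ∀ v ∈ x.2, v.length = c.m)
    (fun c x => x.1.select c.orc x.2) := by
  have hf : Comp (fun c (x : Raw × List Vec) => x.1 = c.I.raw ∧ ∀ v ∈ x.2, v.length = c.m)
      (fun _ x => x.2.filter fun v => decide (ConstrainedElection.ones v = x.1.2.1)) :=
    filter (D₁ := fun _ _ => True) snd_id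
      (f := fun _ (x : Raw × List Vec) v => decide (ConstrainedElection.ones v = x.1.2.1))
      (fst_id.ones.natEq snd_id.fst.snd.fst)
  have hp := prune (l := fun _ _ => []) fst_id (const _) hf fun c x hx =>
    ⟨hx.1, fun w hw => hx.2 w (List.mem_of_mem_filter hw)⟩
  exact listElim (D₁ := fun _ _ => True) hp (const none) (f := fun _ _ v _ => Option.some v)
    (Comp.some fst_id)

theorem solve : Comp (fun c r => r = c.I.raw) (fun c r => r.solve c.orc) := by
  have hinit : ∀ (c : Ctx), ∀ u ∈ c.I.raw.nodes c.orc, TableOK c.m u.2.2 := by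
    intro c u hu
    simp only [Raw.nodes, List.mem_map] at hu
    obtain ⟨x, _, rfl⟩ := hu
    refine TableOK.filter ?_ _
    have := tableOK_table c.orc c.I.raw.1.1 x.1
    rwa [c.I.length_cands] at this
  have hloop := mergeAll.comp (f := fun c r => (r.nodes c.orc, r)) (D := fun c r => r = c.I.raw)
    (nodes.pair id') (by rintro c _ rfl; exact ⟨rfl, hinit c⟩)
  have hsel : Comp (fun c (x : Node × List Node × Raw) => x.2.2 = c.I.raw ∧
      ∀ v ∈ x.1.2.2, v.length = c.m) (fun c x => x.2.2.select c.orc x.1.2.2) :=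
    select.comp (f := fun _ (x : Node × List Node × Raw) => (x.2.2, x.1.2.2))
      (snd_id.snd.pair fst_id.snd.snd) fun _ _ h => h
  refine listElim (f := fun c r u _ => Raw.select c.orc r u.2.2) hloop (const none) hsel ?_
  rintro c _ u t rfl h
  -- The size invariant is needed once more after the loop: it shows that the final table holds
  -- vectors of length `m`, so that the oracle may be consulted in the selection.
  have hinv : ∀ (l live : List Node), LiveOK c.m (c.I.raw.nodes c.orc) live →
      LiveOK c.m (c.I.raw.nodes c.orc) (l.foldl (fun live _ =>
        ConstrainedElection.mergeRound c.orc c.I.raw.reach live) live) := by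
    intro l
    induction l with
    | nil => exact fun _ h => h
    | cons v l ih => exact fun _ h => ih _ (h.mergeRound _ _)
  have := hinv (c.I.raw.nodes c.orc) _ ⟨le_rfl, fun u hu => ⟨hinit c u hu, u, hu, rfl, rfl⟩⟩
  simp only at h
  rw [h] at this
  exact ⟨rfl, (this.2 u List.mem_cons_self).1.1⟩

end Comp

/-- The time analysis relies on counting signatures alone; the structure of the labels and the
properties of the order belong to correctness. -/
theorem exists_solver : ∃ M : Prog, ∀ Q : Polynomial ℕ, ∃ P : Polynomial ℕ,
    ∀ (I : Input) (ge : I.Committee → I.Committee → Prop) (R : Prog), ComputesOrder Q R I ge →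
      RunsWithin P (M.link R) I.encode (enc (I.raw.solve (vecOrder ge))) := by
  obtain ⟨M, hM⟩ := Comp.solve
  refine ⟨M, fun Q => ?_⟩
  obtain ⟨P, hP⟩ := hM Q
  refine ⟨P, fun I ge R h => ?_⟩
  have := hP ⟨I, ge, R, Q, h⟩ rfl I.raw rfl
  rw [enc_input_raw, esize, enc_input_raw] at this
  exact this

/-! ### Correctness of the tables -/

/-- A rejected vector is covered by the entry that caused the rejection, and a displaced entry by
the vector replacing it. Transitivity carries the comparison through all later insertions. -/
theorem prune_covers {orc : Vec → Vec → Bool} {l : Vec}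
    (htotal : ∀ v w, orc v w = true ∨ orc w v = true)
    (htrans : ∀ v w z, orc v w = true → orc w z = true → orc v z = true) {L : List Vec} {v : Vec}
    (hv : v ∈ L) : ∃ w ∈ prune orc l L, sameSig l w v = true ∧ orc w v = true := by
  have hrefl : ∀ v, orc v v = true := fun v => (htotal v v).elim id id
  have hins : ∀ (T : List Vec) (v w : Vec), w = v ∨ w ∈ T →
      ∃ z ∈ ins orc l T v, sameSig l z w = true ∧ orc z w = true := by
    intro T v w hw
    unfold ins
    split_ifs with h
    · rcases hw with rfl | hw
      · simpa using h
      · exact ⟨w, hw, sameSig_iff.2 ⟨rfl, rfl⟩, hrefl w⟩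
    · rcases hw with rfl | hw
      · exact ⟨w, List.mem_cons_self, sameSig_iff.2 ⟨rfl, rfl⟩, hrefl w⟩
      · by_cases hs : sameSig l w v = true
        · refine ⟨v, List.mem_cons_self, ?_, ?_⟩
          · rw [sameSig_iff] at hs ⊢
            exact ⟨hs.1.symm, hs.2.symm⟩
          -- The insertion was not refused, so `w` does not beat `v`; by totality `v` beats `w`.
          · refine (htotal v w).resolve_right fun ho => h ?_
            exact List.any_eq_true.2 ⟨w, hw, by simp [hs, ho]⟩
        · exact ⟨w, List.mem_cons_of_mem _ (List.mem_filter.2 ⟨hw, by simp [hs]⟩),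
            sameSig_iff.2 ⟨rfl, rfl⟩, hrefl w⟩
  have key : ∀ (L T : List Vec) (v : Vec), v ∈ T ∨ v ∈ L →
      ∃ w ∈ L.foldl (ins orc l) T, sameSig l w v = true ∧ orc w v = true := by
    intro L
    induction L with
    | nil =>
      intro T v hv
      exact ⟨v, by simpa using hv, sameSig_iff.2 ⟨rfl, rfl⟩, hrefl v⟩
    | cons x L ih =>
      intro T v hv
      have : v = x ∨ v ∈ T ∨ v ∈ L := by
        rcases hv with h | h
        · exact .inr (.inl h)
        · rcases List.mem_cons.1 h with h | h
          · exact .inl h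
          · exact .inr (.inr h)
      have hstep : ∀ w, w = x ∨ w ∈ T → ∃ z ∈ (x :: L).foldl (ins orc l) T,
          sameSig l z w = true ∧ orc z w = true := by
        intro w hw
        obtain ⟨z, hz, hs, ho⟩ := hins T x w hw
        obtain ⟨z', hz', hs', ho'⟩ := ih (ins orc l T x) z (.inl hz)
        rw [sameSig_iff] at hs hs'
        exact ⟨z', hz', sameSig_iff.2 ⟨hs'.1.trans hs.1, hs'.2.trans hs.2⟩, htrans _ _ _ ho' ho⟩
      rcases this with h | h | h
      · exact hstep v (.inl h)
      · exact hstep v (.inr h)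
      · exact ih _ v (.inr h)
  exact key L [] v (.inr hv)

section Tables
variable {m : ℕ} {ge : Finset (Fin m) → Finset (Fin m) → Prop}

theorem vecOrder_vec {X Y : Finset (Fin m)} : vecOrder ge (vec X) (vec Y) = true ↔ ge X Y := by
  simp only [vecOrder, decide_eq_true_eq]
  rw [toSet_vec, toSet_vec]

theorem IsWeakOrder.refl (h : IsWeakOrder ge) (X : Finset (Fin m)) : ge X X :=
  (h.1 X X).elim id id

theorem IsWeakOrder.prune_covers (h : IsWeakOrder ge) {l : Vec} {L : List Vec} {v : Vec}
    (hv : v ∈ L) : ∃ w ∈ prune (vecOrder ge) l L, sameSig l w v = true ∧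
      vecOrder ge w v = true := by
  refine ConstrainedElection.prune_covers (fun v w => ?_) (fun u v w => ?_) hv
  · simpa [vecOrder] using h.1 _ _
  · simpa [vecOrder] using h.2 _ _ _

/-- All entries of `T` are subsets of `U`. -/
def SubsetsOf (U : Finset (Fin m)) (T : List Vec) : Prop := ∀ v ∈ T, ∃ X, X ⊆ U ∧ v = vec X

theorem SubsetsOf.prune {U : Finset (Fin m)} {L : List Vec} (h : SubsetsOf U L)
    {orc : Vec → Vec → Bool} {l : Vec} : SubsetsOf U (prune orc l L) :=
  fun v hv => h v (mem_prune hv)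

theorem SubsetsOf.filter {U : Finset (Fin m)} {L : List Vec} (h : SubsetsOf U L)
    (p : Vec → Bool) : SubsetsOf U (L.filter p) :=
  fun v hv => h v (List.mem_of_mem_filter hv)

theorem SubsetsOf.mem_joins {U U' : Finset (Fin m)} {T T' : List Vec} (h : SubsetsOf U T)
    (h' : SubsetsOf U' T') {v : Vec} (hv : v ∈ joins T T') : ∃ X Y, X ⊆ U ∧ Y ⊆ U' ∧ vec X ∈ T ∧
      vec Y ∈ T' ∧ v = vec (X ∪ Y) := by
  simp only [joins, List.mem_flatMap, List.mem_map] at hv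
  obtain ⟨x, hx, y, hy, rfl⟩ := hv
  obtain ⟨X, hX, rfl⟩ := h x hx
  obtain ⟨Y, hY, rfl⟩ := h' y hy
  exact ⟨X, Y, hX, hY, hx, hy, vor_vec X Y⟩

theorem SubsetsOf.joins {U U' : Finset (Fin m)} {T T' : List Vec} (h : SubsetsOf U T)
    (h' : SubsetsOf U' T') : SubsetsOf (U ∪ U') (joins T T') := by
  intro v hv
  obtain ⟨X, Y, hX, hY, -, -, rfl⟩ := h.mem_joins h' hv
  exact ⟨_, Finset.union_subset_union hX hY, rfl⟩

theorem vec_union_mem_joins {X Y : Finset (Fin m)} {T T' : List Vec} (h : vec X ∈ T)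
    (h' : vec Y ∈ T') : vec (X ∪ Y) ∈ joins T T' := by
  simp only [ConstrainedElection.joins, List.mem_flatMap, List.mem_map]
  exact ⟨_, h, _, h', vor_vec X Y⟩

/-- `X` can replace the part of `Y` in `U`. -/
def Replaces (ge : Finset (Fin m) → Finset (Fin m) → Prop) (U Y X : Finset (Fin m)) : Prop :=
  X ⊆ U ∧ X.card = (Y ∩ U).card ∧ ge X (Y ∩ U)

/-- Exchange one block at a time: `X ∪ X'` is at least as good as `(Y ∩ U) ∪ X'`, which is at least
as good as `(Y ∩ U) ∪ (Y ∩ U')`. Each exchange preserves cardinality and is disjoint from the part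
kept fixed, so responsiveness applies. -/
theorem Replaces.union (hw : IsWeakOrder ge) (hr : FixedCardinalityResponsive ge)
    {U U' Y X X' : Finset (Fin m)} (hU : Disjoint U U') (h : Replaces ge U Y X)
    (h' : Replaces ge U' Y X') : Replaces ge (U ∪ U') Y (X ∪ X') := by
  obtain ⟨h₁, h₂, h₃⟩ := h
  obtain ⟨h₁', h₂', h₃'⟩ := h'
  have hY : Y ∩ U ⊆ U := Finset.inter_subset_right
  have hY' : Y ∩ U' ⊆ U' := Finset.inter_subset_right
  have he : Y ∩ (U ∪ U') = Y ∩ U ∪ Y ∩ U' := Finset.inter_union_distrib_left _ _ _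
  refine ⟨Finset.union_subset_union h₁ h₁', ?_, ?_⟩
  · rw [he, Finset.card_union_of_disjoint (hU.mono h₁ h₁'),
      Finset.card_union_of_disjoint (hU.mono hY hY'), h₂, h₂']
  · have a := hr _ _ X' h₂ (hU.symm.mono h₁' h₁) (hU.symm.mono h₁' hY) h₃
    have b := hr _ _ (Y ∩ U) h₂' (hU.mono hY h₁') (hU.mono hY hY') h₃'
    rw [Finset.union_comm, Finset.union_comm (Y ∩ U')] at b
    rw [he]
    exact hw.2 _ _ _ a b

/-- The signature contains the size, so the pruned representative is still a replacement, and it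
contains the count in `l`, so later dominance checks give the same result. -/
theorem Replaces.prune (hw : IsWeakOrder ge) {U Y X l : Finset (Fin m)} {L : List Vec}
    (h : Replaces ge U Y X) (hL : SubsetsOf U L) (hX : vec X ∈ L) :
    ∃ X', Replaces ge U Y X' ∧ vec X' ∈ prune (vecOrder ge) (vec l) L ∧
      (X' ∩ l).card = (X ∩ l).card := by
  obtain ⟨w, hwm, hs, ho⟩ := hw.prune_covers (l := vec l) hX
  obtain ⟨X', hX', rfl⟩ := hL w (mem_prune hwm)
  rw [sameSig_iff, meet_vec, meet_vec, ones_vec, ones_vec] at hs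
  exact ⟨X', ⟨hX', hs.2.trans h.2.1, hw.2 _ _ _ (vecOrder_vec.1 ho) h.2.2⟩, hwm, hs.1⟩

/-- `T` consists of subsets of `U` and contains best ones of each size. -/
def BestSubsets (ge : Finset (Fin m) → Finset (Fin m) → Prop) (U : Finset (Fin m))
    (T : List Vec) : Prop :=
  SubsetsOf U T ∧ ∀ Y, ∃ X, Replaces ge U Y X ∧ vec X ∈ T

/-- A single candidate of the label is a block with only two possible parts, both offered by the
join, so this is one union of replacements followed by pruning. -/
theorem bestSubsets_tableStep (hw : IsWeakOrder ge) (hr : FixedCardinalityResponsive ge)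
    {l U : Finset (Fin m)} {T : List Vec} {c : Fin m} (hc : c ∉ U) (h : BestSubsets ge U T) :
    BestSubsets ge (U ∪ (l ∩ {c})) (tableStep (vecOrder ge) (candList m) (vec l) T c) := by
  unfold tableStep
  rw [singleVec_candList, zeroVec_candList, meet_vec]
  by_cases hcl : c ∈ l
  · have h₁ : ({c} ∩ l : Finset (Fin m)) = {c} := by simpa using hcl
    have h₂ : SubsetsOf ({c} : Finset (Fin m)) [vec (∅ : Finset (Fin m)), vec {c}] := by
      intro v hv
      simp only [List.mem_cons, List.not_mem_nil, or_false] at hv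
      rcases hv with rfl | rfl
      · exact ⟨∅, by simp, rfl⟩
      · exact ⟨{c}, subset_rfl, rfl⟩
    rw [Finset.inter_comm l, h₁]
    simp only [Finset.card_singleton, one_ne_zero, decide_false, Bool.false_eq_true, if_false]
    refine ⟨(h.1.joins h₂).prune, fun Y => ?_⟩
    obtain ⟨X, hX, hXT⟩ := h.2 Y
    have hY : Y ∩ {c} = ∅ ∨ Y ∩ {c} = {c} := by
      by_cases hcY : c ∈ Y
      · exact .inr (by simpa using hcY)
      · exact .inl (Finset.inter_singleton_of_notMem hcY)
    have hc' : Replaces ge {c} Y (Y ∩ {c}) := ⟨Finset.inter_subset_right, rfl, hw.refl _⟩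
    have hmem : vec (Y ∩ {c}) ∈ [vec (∅ : Finset (Fin m)), vec {c}] := by
      rcases hY with h | h <;> rw [h] <;> simp
    obtain ⟨X', hX', hm, -⟩ := (hX.union hw hr (by simpa using hc) hc').prune hw (l := l)
      (h.1.joins h₂) (vec_union_mem_joins hXT hmem)
    exact ⟨X', hX', hm⟩
  · have h₁ : ({c} ∩ l : Finset (Fin m)) = ∅ := Finset.singleton_inter_of_notMem hcl
    rw [Finset.inter_comm l, h₁]
    simpa using h

theorem bestSubsets_table (hw : IsWeakOrder ge) (hr : FixedCardinalityResponsive ge)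
    (l : Finset (Fin m)) : BestSubsets ge l (table (vecOrder ge) (candList m) (vec l)) := by
  -- Here `U` is the part of the label already processed and `cs` are the candidates still to come;
  -- being fresh and distinct, they keep the blocks disjoint.
  have key : ∀ (cs : List (Fin m)) (U : Finset (Fin m)) (T : List Vec), cs.Nodup →
      (∀ c ∈ cs, c ∉ U) → BestSubsets ge U T → BestSubsets ge (U ∪ (l ∩ cs.toFinset))
        ((cs.map Fin.val).foldl (tableStep (vecOrder ge) (candList m) (vec l)) T) := by
    intro cs
    induction cs with
    | nil => intro U T _ _ h; simpa using h
    | cons c cs ih =>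
      intro U T hn hU h
      rw [List.nodup_cons] at hn
      have h₁ := ih _ _ hn.2 (fun d hd => ?_)
        (bestSubsets_tableStep hw hr (l := l) (hU c List.mem_cons_self) h)
      · have he : U ∪ (l ∩ {c}) ∪ (l ∩ cs.toFinset) = U ∪ (l ∩ (c :: cs).toFinset) := by
          ext d
          simp only [Finset.mem_union, Finset.mem_inter, Finset.mem_singleton, List.mem_toFinset,
            List.mem_cons]
          tauto
        rw [he] at h₁
        exact h₁
      · have hdc : d ≠ c := fun h => hn.1 (h ▸ hd)
        simp [hU d (List.mem_cons_of_mem _ hd), hdc]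
  have h₀ : BestSubsets ge ∅ [vec (∅ : Finset (Fin m))] := by
    refine ⟨fun v hv => ⟨∅, subset_rfl, by simpa using hv⟩, fun Y => ⟨∅, ?_, by simp⟩⟩
    exact ⟨subset_rfl, by simp, by simpa using hw.refl _⟩
  have h := key (List.finRange m) ∅ _ (List.nodup_finRange m) (by simp) h₀
  rw [← zeroVec_candList] at h
  have he : (List.finRange m).map Fin.val = candList m := by
    rw [candList, List.ofFn_eq_map]
  rw [he] at h
  have hl : ∅ ∪ (l ∩ (List.finRange m).toFinset) = l := by
    ext c; simp
  rw [hl] at h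
  exact h

end Tables

/-! ### Reachability -/

theorem has_iff {P : List (ℕ × ℕ)} {x y : ℕ} : has P x y = true ↔ (x, y) ∈ P := by
  simp only [has, List.any_eq_true, Bool.and_eq_true, decide_eq_true_eq]
  constructor
  · rintro ⟨⟨a, b⟩, h, rfl, rfl⟩
    exact h
  · exact fun h => ⟨_, h, rfl, rfl⟩

/-- A path through the new edge can be cut before its first and after its last use of that edge, so
one use is enough. The closure can thus be updated edge by edge. -/
theorem reflTransGen_insert {α : Type} {r : α → α → Prop} {a b x y : α} :
    Relation.ReflTransGen (fun u v => r u v ∨ (u = a ∧ v = b)) x y ↔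
      Relation.ReflTransGen r x y ∨
        (Relation.ReflTransGen r x a ∧ Relation.ReflTransGen r b y) := by
  have hmono : ∀ {x y}, Relation.ReflTransGen r x y →
      Relation.ReflTransGen (fun u v => r u v ∨ (u = a ∧ v = b)) x y :=
    fun h => Relation.ReflTransGen.mono (fun _ _ => Or.inl) _ _ h
  constructor
  · intro h
    induction h with
    | refl => exact .inl .refl
    | tail _ h ih =>
      rcases h with h | ⟨rfl, rfl⟩
      · exact ih.imp (·.tail h) fun ih => ⟨ih.1, ih.2.tail h⟩
      · exact .inr ⟨ih.elim id And.left, .refl⟩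
  · rintro (h | ⟨h₁, h₂⟩)
    · exact hmono h
    · exact ((hmono h₁).tail (.inr ⟨rfl, rfl⟩)).trans (hmono h₂)

/-- The dominance constraints in a list, as a relation between the numbers of the labels. -/
def RawEdge (cs : List RawConstraint) (x y : ℕ) : Prop := .inr (x, y) ∈ cs

/-- Since all edges stay inside `S`, no intermediate vertex of a path is lost by recording only
pairs from `S`. -/
theorem mem_reach {S : List ℕ} {cs : List RawConstraint}
    (hS : ∀ x y, RawEdge cs x y → x ∈ S ∧ y ∈ S) {x y : ℕ} :
    (x, y) ∈ reach (S ×ˢ S) cs ↔ x ∈ S ∧ y ∈ S ∧ Relation.ReflTransGen (RawEdge cs) x y := by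
  induction cs using List.reverseRecOn generalizing x y with
  | nil =>
    have h : Relation.ReflTransGen (RawEdge []) x y ↔ x = y := by
      rw [Relation.reflTransGen_iff_eq]
      · exact eq_comm
      · simp [RawEdge]
    rw [h]
    simp [reach, List.mem_filter, List.mem_product, and_assoc]
  | append_singleton cs c ih =>
    have ih := fun {x y} => ih (x := x) (y := y) fun x y h => hS x y (List.mem_append_left _ h)
    have hr : reach (S ×ˢ S) (cs ++ [c]) = reachStep (S ×ˢ S) (reach (S ×ˢ S) cs) c := by
      simp [reach]
    rw [hr]
    rcases c with c | ⟨a, b⟩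
    · have h : RawEdge (cs ++ [.inl c]) = RawEdge cs := by
        funext x y; simp [RawEdge]
      rw [h, ← ih]
      rfl
    · have h : RawEdge (cs ++ [.inr (a, b)]) = fun u v => RawEdge cs u v ∨ (u = a ∧ v = b) := by
        funext x y; simp [RawEdge]
      obtain ⟨ha, hb⟩ := hS a b (by simp [RawEdge])
      rw [h, reflTransGen_insert]
      change _ ∈ addEdge _ _ _ ↔ _
      simp only [addEdge, List.mem_filter, List.mem_product, Bool.or_eq_true, Bool.and_eq_true,
        has_iff, ih]
      tauto

/-! ### Correctness of the main loop -/

namespace Input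
variable (I : Input)

/-- The label with number `x`; the number `numLabels` stands for the candidates without label. -/
def labelNum (x : ℕ) : Finset (Fin I.election.m) :=
  if h : x < I.numLabels then I.label ⟨x, h⟩ else
    Finset.univ.filter fun c => ∀ i, c ∉ I.label i

@[simp] theorem labelNum_val (i : Fin I.numLabels) : I.labelNum i = I.label i := by
  simp [labelNum]

def allNums : List ℕ := List.range (I.numLabels + 1)

theorem mem_allNums {x : ℕ} : x ∈ I.allNums ↔ x ≤ I.numLabels := by
  simp [allNums]

/-- The reflexive transitive closure of the dominance constraints. -/
def Dom (x y : ℕ) : Prop := Relation.ReflTransGen (RawEdge I.raw.2.2.2) x y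

theorem rawEdge_iff {x y : ℕ} : RawEdge I.raw.2.2.2 x y ↔
    ∃ i j : Fin I.numLabels, Constraint.dominance i j ∈ I.constraints ∧ (i : ℕ) = x ∧ (j : ℕ) = y := by
  simp only [RawEdge, raw, List.mem_map]
  constructor
  · rintro ⟨_ | ⟨i, j⟩, h, he⟩
    · simp [Constraint.raw] at he
    · simp only [Constraint.raw, Sum.inr.injEq, Prod.mk.injEq] at he
      exact ⟨i, j, h, he⟩
  · rintro ⟨i, j, h, rfl, rfl⟩
    exact ⟨_, h, rfl⟩

theorem dom_iff {x y : ℕ} : I.Dom x y ↔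
    x = y ∨ ∃ i j : Fin I.numLabels, I.DominanceEdge i j ∧ (i : ℕ) = x ∧ (j : ℕ) = y := by
  constructor
  · intro h
    induction h with
    | refl => exact .inl rfl
    | tail _ hyz ih =>
      obtain ⟨i, j, hij, rfl, rfl⟩ := I.rawEdge_iff.1 hyz
      refine .inr ?_
      rcases ih with rfl | ⟨i', j', h', rfl, hj⟩
      · exact ⟨i, j, .single hij, rfl, rfl⟩
      · obtain rfl := Fin.ext hj
        exact ⟨i', j, .tail h' hij, rfl, rfl⟩
  · rintro (rfl | ⟨i, j, h, rfl, rfl⟩)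
    · exact .refl
    · exact Relation.TransGen.to_reflTransGen
        (Relation.TransGen.lift Fin.val (fun a b h => I.rawEdge_iff.2 ⟨a, b, h, rfl, rfl⟩) _ _ h)

/-- Passing to the reflexive closure absorbs all coincidences between the labels: any two nodes
above a common one are comparable. The extra number of the unlabelled class is related only to
itself. -/
theorem TreeLike.dom {I : Input} (h : I.TreeLike) {x y z : ℕ} (hx : I.Dom x z) (hy : I.Dom y z) :
    I.Dom x y ∨ I.Dom y x := by
  rcases I.dom_iff.1 hx with rfl | ⟨i, k, hik, rfl, rfl⟩
  · exact .inr hy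
  rcases I.dom_iff.1 hy with rfl | ⟨j, k', hjk, rfl, hk⟩
  · exact .inl hx
  obtain rfl := Fin.ext hk
  by_cases hij : i = j
  · exact .inl (I.dom_iff.2 (.inl (congrArg _ hij)))
  by_contra hn
  rw [not_or] at hn
  exact h ⟨i, j, k', hij, hik, hjk, fun h' => hn.1 (I.dom_iff.2 (.inr ⟨i, j, h', rfl, rfl⟩)),
    fun h' => hn.2 (I.dom_iff.2 (.inr ⟨j, i, h', rfl, rfl⟩))⟩

theorem allLabels_raw : I.raw.allLabels = I.allNums.map fun x => vec (I.labelNum x) := by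
  have h₁ : (List.ofFn fun i => vec (I.label i)) =
      (List.range I.numLabels).map fun x => vec (I.labelNum x) := by
    apply List.ext_getElem
    · simp
    · intro i h₁ h₂
      have : i < I.numLabels := by simpa using h₁
      simp [labelNum, this]
  have h₂ : (candList I.election.m).map (fun i => !(List.ofFn fun i => vec (I.label i)).any
      fun l => !decide (meet l (singleVec (candList I.election.m) i) = 0)) =
      vec (I.labelNum I.numLabels) := by
    rw [candList, List.map_ofFn, vec]
    congr 1
    funext c
    -- The algorithm tests membership by intersecting with a singleton.
    have h : ∀ i, meet (vec (I.label i)) (singleVec (candList I.election.m) c) = 0 ↔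
        c ∉ I.label i := by
      intro i
      rw [singleVec_candList, meet_vec, Finset.card_eq_zero, ← Finset.disjoint_iff_inter_eq_empty,
        Finset.disjoint_singleton_left]
    rw [Bool.eq_iff_iff]
    simp only [Function.comp_apply, Bool.not_eq_true', List.any_eq_false, List.mem_ofFn,
      decide_eq_true_eq, decide_eq_false_iff_not,
      labelNum, lt_irrefl, dite_false, Finset.mem_filter, Finset.mem_univ, true_and]
    constructor
    · intro H i
      exact (h i).1 (not_not.1 (H _ ⟨i, rfl⟩))
    · rintro H _ ⟨i, rfl⟩
      exact not_not.2 ((h i).2 (H i))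
  have h₃ : I.raw.allLabels = (List.ofFn fun i => vec (I.label i)) ++
      [(candList I.election.m).map (fun i => !(List.ofFn fun i => vec (I.label i)).any
        fun l => !decide (meet l (singleVec (candList I.election.m) i) = 0))] := rfl
  rw [h₃, h₂, h₁, allNums, List.range_succ, List.map_append]
  rfl

theorem zipIdx_allLabels :
    I.raw.allLabels.zipIdx = I.allNums.map fun x => (vec (I.labelNum x), x) := by
  rw [allLabels_raw]
  apply List.ext_getElem
  · simp
  · intro i h₁ h₂
    simp [allNums]

theorem has_reach {x y : ℕ} (hx : x ≤ I.numLabels) (hy : y ≤ I.numLabels) :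
    has I.raw.reach x y = true ↔ I.Dom x y := by
  have hp : I.raw.pairs = I.allNums ×ˢ I.allNums := by
    rw [Raw.pairs, zipIdx_allLabels, List.map_map]
    simp [Function.comp_def]
  rw [has_iff, Raw.reach, hp, mem_reach, mem_allNums, mem_allNums]
  · exact ⟨fun h => h.2.2, fun h => ⟨hx, hy, h⟩⟩
  · intro x y h
    obtain ⟨i, j, -, rfl, rfl⟩ := I.rawEdge_iff.1 h
    exact ⟨I.mem_allNums.2 i.2.le, I.mem_allNums.2 j.2.le⟩

/-- Number of members of `X` with the label number `x`. -/
def cnt (X : I.Committee) (x : ℕ) : ℕ := (X ∩ I.labelNum x).card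

def SatisfiesAll (X : I.Committee) : Prop := ∀ c ∈ I.constraints, I.Satisfies X c

variable {I}

theorem SatisfiesAll.cnt_le {X : I.Committee} (h : I.SatisfiesAll X) {x y : ℕ} (hxy : I.Dom x y) :
    I.cnt X y ≤ I.cnt X x := by
  induction hxy with
  | refl => exact le_rfl
  | tail _ hyz ih =>
    obtain ⟨i, j, hij, rfl, rfl⟩ := I.rawEdge_iff.1 hyz
    refine le_trans ?_ ih
    have : (X ∩ I.label j).card ≤ (X ∩ I.label i).card := h _ hij
    simpa [cnt] using this

theorem intervalsOK_raw {x n : ℕ} : intervalsOK I.raw.2.2.2 x n = true ↔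
    ∀ p q i, Constraint.interval p q i ∈ I.constraints → (i : ℕ) = x → p ≤ n ∧ n ≤ q := by
  simp only [intervalsOK, raw, List.all_map, List.all_eq_true]
  constructor
  · intro h p q i hc hi
    have := h _ hc
    simpa [Constraint.raw, hi] using this
  · rintro h (⟨p, q, i⟩ | ⟨i, j⟩) hc
    · by_cases hi : (i : ℕ) = x
      · simpa [Constraint.raw, hi] using h p q i hc hi
      · simp [Constraint.raw, hi]
    · simp [Constraint.raw]

theorem disjoint_labelNum (hd : I.DisjointLabels) {x y : ℕ} (hx : x ≤ I.numLabels)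
    (hy : y ≤ I.numLabels) (hxy : x ≠ y) : Disjoint (I.labelNum x) (I.labelNum y) := by
  unfold labelNum
  split_ifs with h₁ h₂ h₂
  · exact hd _ _ fun h => hxy (congrArg Fin.val h)
  · rw [Finset.disjoint_left]
    intro c hc
    simp only [Finset.mem_filter, Finset.mem_univ, true_and, not_forall, not_not]
    exact ⟨_, hc⟩
  · rw [Finset.disjoint_right]
    intro c hc
    simp only [Finset.mem_filter, Finset.mem_univ, true_and, not_forall, not_not]
    exact ⟨_, hc⟩
  · omega

theorem exists_mem_labelNum (c : Fin I.election.m) : ∃ x ≤ I.numLabels, c ∈ I.labelNum x := by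
  by_cases h : ∃ i, c ∈ I.label i
  · obtain ⟨i, hi⟩ := h
    exact ⟨i, i.2.le, by simpa using hi⟩
  · refine ⟨I.numLabels, le_rfl, ?_⟩
    simpa [labelNum] using h

end Input

/-- Invariant of the main loop: every node `u` stands for a block `U u.1` of candidates. -/
structure LiveInv (I : Input) (ge : I.Committee → I.Committee → Prop) (live : List Node)
    (U : ℕ → I.Committee) : Prop where
  nodup : (live.map fun u => u.1).Nodup
  le : ∀ u ∈ live, u.1 ≤ I.numLabels
  lab : ∀ u ∈ live, u.2.1 = vec (I.labelNum u.1)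
  sub : ∀ u ∈ live, I.labelNum u.1 ⊆ U u.1
  disj : ∀ u ∈ live, ∀ v ∈ live, u.1 ≠ v.1 → Disjoint (U u.1) (U v.1)
  cover : ∀ c, ∃ u ∈ live, c ∈ U u.1
  subsets : ∀ u ∈ live, SubsetsOf (U u.1) u.2.2
  complete : ∀ Y, I.SatisfiesAll Y → ∀ u ∈ live, ∃ X, Replaces ge (U u.1) Y X ∧
    vec X ∈ u.2.2 ∧ I.cnt X u.1 = I.cnt Y u.1
  sound : ∀ Z, (∀ u ∈ live, vec (Z ∩ U u.1) ∈ u.2.2) →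
    (∀ u ∈ live, ∀ v ∈ live, I.Dom u.1 v.1 → I.cnt Z v.1 ≤ I.cnt Z u.1) → I.SatisfiesAll Z

variable {I : Input} {ge : I.Committee → I.Committee → Prop}

/-- Initially each block is its own label, so a replacement of the same size has the same label
count and passes the same interval constraints. Conversely, the filtered tables enforce the interval
constraints and the relations between nodes include every dominance constraint. -/
theorem liveInv_nodes (hw : IsWeakOrder ge) (hr : FixedCardinalityResponsive ge)
    (hd : I.DisjointLabels) : LiveInv I ge (I.raw.nodes (vecOrder ge)) I.labelNum := by
  have hnodes : I.raw.nodes (vecOrder ge) = I.allNums.map fun x => (x, vec (I.labelNum x),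
      (table (vecOrder ge) (candList I.election.m) (vec (I.labelNum x))).filter
        fun v => intervalsOK I.raw.2.2.2 x (ones v)) := by
    rw [Raw.nodes, I.zipIdx_allLabels, List.map_map]
    rfl
  have hmem : ∀ u, u ∈ I.raw.nodes (vecOrder ge) ↔ ∃ x ≤ I.numLabels, u = (x, vec (I.labelNum x),
      (table (vecOrder ge) (candList I.election.m) (vec (I.labelNum x))).filter
        fun v => intervalsOK I.raw.2.2.2 x (ones v)) := by
    intro u
    rw [hnodes, List.mem_map]
    simp only [I.mem_allNums, eq_comm]
  have hbest := fun x => bestSubsets_table hw hr (I.labelNum x)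
  constructor
  · rw [hnodes, List.map_map]
    simpa [Function.comp_def, Input.allNums] using List.nodup_range
  · intro u hu
    obtain ⟨x, hx, rfl⟩ := (hmem u).1 hu
    exact hx
  · intro u hu
    obtain ⟨x, hx, rfl⟩ := (hmem u).1 hu
    rfl
  · exact fun u _ => subset_rfl
  · intro u hu v hv huv
    obtain ⟨x, hx, rfl⟩ := (hmem u).1 hu
    obtain ⟨y, hy, rfl⟩ := (hmem v).1 hv
    exact Input.disjoint_labelNum hd hx hy huv
  · intro c
    obtain ⟨x, hx, hc⟩ := Input.exists_mem_labelNum c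
    exact ⟨_, (hmem _).2 ⟨x, hx, rfl⟩, hc⟩
  · intro u hu
    obtain ⟨x, hx, rfl⟩ := (hmem u).1 hu
    exact (hbest x).1.filter _
  · intro Y hY u hu
    obtain ⟨x, hx, rfl⟩ := (hmem u).1 hu
    obtain ⟨X, hX, hT⟩ := (hbest x).2 Y
    refine ⟨X, hX, List.mem_filter.2 ⟨hT, ?_⟩, ?_⟩
    · rw [ones_vec, Input.intervalsOK_raw]
      rintro p q i hc rfl
      have : p ≤ (Y ∩ I.label i).card ∧ (Y ∩ I.label i).card ≤ q := hY _ hc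
      rw [hX.2.1]
      simpa using this
    · rw [Input.cnt, Finset.inter_eq_left.2 hX.1]
      exact hX.2.1
  · rintro Z hT hrel (⟨p, q, i⟩ | ⟨i, j⟩) hc
    · have := hT _ ((hmem _).2 ⟨i, i.2.le, rfl⟩)
      have := (List.mem_filter.1 this).2
      rw [ones_vec, Input.intervalsOK_raw] at this
      change _ ≤ (Z ∩ I.label i).card ∧ (Z ∩ I.label i).card ≤ _
      simpa using this p q i hc rfl
    · have := hrel _ ((hmem _).2 ⟨i, i.2.le, rfl⟩) _ ((hmem _).2 ⟨j, j.2.le, rfl⟩)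
        (.single (I.rawEdge_iff.2 ⟨i, j, hc, rfl, rfl⟩))
      change (Z ∩ I.label j).card ≤ (Z ∩ I.label i).card
      simpa [Input.cnt] using this

theorem LiveInv.eq_of_num {live : List Node} {U : ℕ → I.Committee} (h : LiveInv I ge live U)
    {u v : Node} (hu : u ∈ live) (hv : v ∈ live) (huv : u.1 = v.1) : u = v :=
  List.inj_on_of_nodup_map h.nodup hu hv huv

/-- Live nodes have numbers in the range on which the computed table of pairs agrees with `Dom`. -/
theorem LiveInv.mergeable_iff {live : List Node} {U : ℕ → I.Committee} (h : LiveInv I ge live U)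
    {u v : Node} (hu : u ∈ live) (hv : v ∈ live) : mergeable I.raw.reach live u v = true ↔
      u.1 ≠ v.1 ∧ ∀ w ∈ live, w.1 ≠ u.1 → w.1 ≠ v.1 →
        (I.Dom w.1 v.1 → I.Dom w.1 u.1 ∧ I.Dom u.1 v.1) ∧
        (I.Dom v.1 w.1 → I.Dom v.1 u.1 ∧ I.Dom u.1 w.1) := by
  have hR : ∀ {x y : Node}, x ∈ live → y ∈ live → (has I.raw.reach x.1 y.1 = true ↔ I.Dom x.1 y.1) :=
    fun hx hy => I.has_reach (h.le _ hx) (h.le _ hy)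
  unfold mergeable
  rw [Bool.and_eq_true, List.all_eq_true]
  simp only [Bool.not_eq_true', decide_eq_false_iff_not, ne_eq]
  refine and_congr Iff.rfl (forall₂_congr fun w hw => ?_)
  have h₁ := hR hw hv
  have h₂ := hR hw hu
  have h₃ := hR hu hv
  have h₄ := hR hv hw
  have h₅ := hR hv hu
  have h₆ := hR hu hw
  simp only [Bool.or_eq_true, Bool.and_eq_true, decide_eq_true_eq, Bool.not_eq_true',
    ← Bool.not_eq_true, h₁, h₂, h₃, h₄, h₅, h₆, or_iff_not_imp_left, not_not]

theorem inter_card_of_subset {m : ℕ} {X Y L U V : Finset (Fin m)} (hY : Y ⊆ V)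
    (hL : L ⊆ U) (hUV : Disjoint U V) : ((X ∪ Y) ∩ L).card = (X ∩ L).card := by
  congr 1
  ext c
  simp only [Finset.mem_inter, Finset.mem_union]
  constructor
  · rintro ⟨hc | hc, hl⟩
    · exact ⟨hc, hl⟩
    · exact absurd (hY hc) (Finset.disjoint_left.1 hUV (hL hl))
  · exact fun h => ⟨.inl h.1, h.2⟩

/-- For completeness, replacements of both parts of a feasible `Y` keep its counts for `u` and `v`;
their union passes the check, and pruning preserves the count of `u`. For soundness, dominances
involving the forgotten node `v` are recovered by chaining through `u`. -/
theorem LiveInv.merge (hw : IsWeakOrder ge) (hr : FixedCardinalityResponsive ge)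
    {live : List Node} {U : ℕ → I.Committee} (h : LiveInv I ge live U) {u v : Node}
    (hu : u ∈ live) (hv : v ∈ live) (hm : mergeable I.raw.reach live u v = true) :
    LiveInv I ge (mergeNodes (vecOrder ge) I.raw.reach u v ::
      live.filter fun w => !decide (w.1 = u.1) && !decide (w.1 = v.1))
      (Function.update U u.1 (U u.1 ∪ U v.1)) := by
  obtain ⟨huv, hm⟩ := (h.mergeable_iff hu hv).1 hm
  have hUV := h.disj u hu v hv huv
  have hrest : ∀ w, w ∈ live.filter (fun w => !decide (w.1 = u.1) && !decide (w.1 = v.1)) ↔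
      w ∈ live ∧ w.1 ≠ u.1 ∧ w.1 ≠ v.1 := by
    intro w
    simp [List.mem_filter]
  set T := (joins u.2.2 v.2.2).filter (respects I.raw.reach u v) with hT
  have hresp : ∀ Z : I.Committee, respects I.raw.reach u v (vec Z) = true ↔
      (I.Dom u.1 v.1 → I.cnt Z v.1 ≤ I.cnt Z u.1) ∧
      (I.Dom v.1 u.1 → I.cnt Z u.1 ≤ I.cnt Z v.1) := by
    intro Z
    have h₁ := I.has_reach (h.le u hu) (h.le v hv)
    have h₂ := I.has_reach (h.le v hv) (h.le u hu)
    simp only [respects, h.lab u hu, h.lab v hv, meet_vec, Bool.and_eq_true, Bool.or_eq_true,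
      Bool.not_eq_true', ← Bool.not_eq_true, decide_eq_true_eq, h₁, h₂, Input.cnt]
    tauto
  have hsubs := (h.subsets u hu).joins (h.subsets v hv)
  have hU : ∀ w : Node, w.1 ≠ u.1 → Function.update U u.1 (U u.1 ∪ U v.1) w.1 = U w.1 :=
    fun w hw => Function.update_of_ne hw _ _
  have hUu : Function.update U u.1 (U u.1 ∪ U v.1) u.1 = U u.1 ∪ U v.1 := Function.update_self _ _ _
  have hcntu : ∀ {X Y : I.Committee}, X ⊆ U u.1 → Y ⊆ U v.1 →
      I.cnt (X ∪ Y) u.1 = I.cnt X u.1 :=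
    fun _ hY => inter_card_of_subset hY (h.sub u hu) hUV
  have hcntv : ∀ {X Y : I.Committee}, X ⊆ U u.1 → Y ⊆ U v.1 →
      I.cnt (X ∪ Y) v.1 = I.cnt Y v.1 := by
    intro X Y hX hY
    rw [Finset.union_comm]
    exact inter_card_of_subset hX (h.sub v hv) hUV.symm
  constructor
  · rw [List.map_cons, List.nodup_cons]
    refine ⟨?_, h.nodup.sublist (List.filter_sublist.map _)⟩
    rw [List.mem_map]
    rintro ⟨w, hw, he⟩
    exact ((hrest w).1 hw).2.1 he
  · intro w hw
    rcases List.mem_cons.1 hw with rfl | hw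
    · exact h.le u hu
    · exact h.le w ((hrest w).1 hw).1
  · intro w hw
    rcases List.mem_cons.1 hw with rfl | hw
    · exact h.lab u hu
    · exact h.lab w ((hrest w).1 hw).1
  · intro w hw
    rcases List.mem_cons.1 hw with rfl | hw
    · refine (h.sub u hu).trans ?_
      change _ ⊆ Function.update U u.1 (U u.1 ∪ U v.1) u.1
      rw [hUu]
      exact Finset.subset_union_left
    · rw [hU w ((hrest w).1 hw).2.1]
      exact h.sub w ((hrest w).1 hw).1
  · have key : ∀ w, w ∈ live → w.1 ≠ u.1 → w.1 ≠ v.1 → Disjoint (U u.1 ∪ U v.1) (U w.1) :=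
      fun w hw h₁ h₂ => Finset.disjoint_union_left.2
        ⟨h.disj u hu w hw h₁.symm, h.disj v hv w hw h₂.symm⟩
    intro w hw z hz hwz
    rcases List.mem_cons.1 hw with rfl | hw <;> rcases List.mem_cons.1 hz with rfl | hz
    · exact absurd rfl hwz
    · obtain ⟨h₁, h₂, h₃⟩ := (hrest z).1 hz
      change Disjoint (Function.update U u.1 (U u.1 ∪ U v.1) u.1) _
      rw [hUu, hU z h₂]
      exact key z h₁ h₂ h₃
    · obtain ⟨h₁, h₂, h₃⟩ := (hrest w).1 hw
      change Disjoint _ (Function.update U u.1 (U u.1 ∪ U v.1) u.1)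
      rw [hUu, hU w h₂]
      exact (key w h₁ h₂ h₃).symm
    · rw [hU w ((hrest w).1 hw).2.1, hU z ((hrest z).1 hz).2.1]
      exact h.disj w ((hrest w).1 hw).1 z ((hrest z).1 hz).1 hwz
  · intro c
    obtain ⟨w, hw, hc⟩ := h.cover c
    by_cases h₁ : w.1 = u.1 ∨ w.1 = v.1
    · refine ⟨_, List.mem_cons_self, ?_⟩
      change c ∈ Function.update U u.1 (U u.1 ∪ U v.1) u.1
      rw [hUu, Finset.mem_union]
      rcases h₁ with h₁ | h₁ <;> rw [h₁] at hc
      · exact .inl hc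
      · exact .inr hc
    · rw [not_or] at h₁
      refine ⟨w, List.mem_cons_of_mem _ ((hrest w).2 ⟨hw, h₁⟩), ?_⟩
      rwa [hU w h₁.1]
  · intro w hw
    rcases List.mem_cons.1 hw with rfl | hw
    · change SubsetsOf (Function.update U u.1 (U u.1 ∪ U v.1) u.1) _
      rw [hUu]
      exact (hsubs.filter _).prune
    · rw [hU w ((hrest w).1 hw).2.1]
      exact h.subsets w ((hrest w).1 hw).1
  · intro Y hY w hw'
    rcases List.mem_cons.1 hw' with rfl | hw'
    · change ∃ X, Replaces ge (Function.update U u.1 (U u.1 ∪ U v.1) u.1) Y X ∧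
        vec X ∈ prune (vecOrder ge) u.2.1 T ∧ I.cnt X u.1 = I.cnt Y u.1
      rw [hUu, h.lab u hu]
      obtain ⟨X₁, hX₁, hT₁, hc₁⟩ := h.complete Y hY u hu
      obtain ⟨X₂, hX₂, hT₂, hc₂⟩ := h.complete Y hY v hv
      have hX : vec (X₁ ∪ X₂) ∈ T := by
        refine List.mem_filter.2 ⟨vec_union_mem_joins hT₁ hT₂, (hresp _).2 ?_⟩
        rw [hcntu hX₁.1 hX₂.1, hcntv hX₁.1 hX₂.1, hc₁, hc₂]
        -- The counts have become those of `Y`, which obeys all dominances.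
        exact ⟨hY.cnt_le, hY.cnt_le⟩
      obtain ⟨X, h₁, h₂, h₃⟩ := (hX₁.union hw hr hUV hX₂).prune hw (l := I.labelNum u.1)
        (hsubs.filter _) hX
      refine ⟨X, h₁, h₂, ?_⟩
      rw [Input.cnt, h₃, ← hc₁]
      exact hcntu hX₁.1 hX₂.1
    · rw [hU w ((hrest w).1 hw').2.1]
      exact h.complete Y hY w ((hrest w).1 hw').1
  · intro Z hZ hrel
    have hZu := hZ _ List.mem_cons_self
    change vec (Z ∩ Function.update U u.1 (U u.1 ∪ U v.1) u.1) ∈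
      prune (vecOrder ge) u.2.1 T at hZu
    rw [hUu] at hZu
    obtain ⟨hj, hresp'⟩ := List.mem_filter.1 (mem_prune hZu)
    obtain ⟨X, Y, hX, hY, hXT, hYT, he⟩ := (h.subsets u hu).mem_joins (h.subsets v hv) hj
    have he := vec_injective he
    -- As the blocks are disjoint, the two constituents of the joined entry are the traces of `Z` on
    -- the two old blocks.
    have hZX : Z ∩ U u.1 = X := by
      have h₁ : Z ∩ U u.1 = (X ∪ Y) ∩ U u.1 := by
        rw [← he, Finset.inter_assoc, Finset.union_inter_cancel_left]
      rw [h₁, Finset.union_inter_distrib_right, Finset.inter_eq_left.2 hX,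
        Finset.disjoint_iff_inter_eq_empty.1 (hUV.symm.mono_left hY), Finset.union_empty]
    have hZY : Z ∩ U v.1 = Y := by
      have h₁ : Z ∩ U v.1 = (X ∪ Y) ∩ U v.1 := by
        rw [← he, Finset.inter_assoc, Finset.union_inter_cancel_right]
      rw [h₁, Finset.union_inter_distrib_right, Finset.inter_eq_left.2 hY,
        Finset.disjoint_iff_inter_eq_empty.1 (hUV.mono_left hX), Finset.empty_union]
    have hcnt : ∀ w, w ∈ live → I.cnt (Z ∩ U w.1) w.1 = I.cnt Z w.1 := by
      intro w hw
      rw [Input.cnt, Finset.inter_assoc, Finset.inter_eq_right.2 (h.sub w hw), Input.cnt]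
    rw [he, hresp, hcntu hX hY, hcntv hX hY, ← hZX, ← hZY, hcnt u hu, hcnt v hv] at hresp'
    refine h.sound Z (fun w hw => ?_) fun w hw z hz hwz => ?_
    · by_cases h₁ : w.1 = u.1
      · rw [h.eq_of_num hw hu h₁, hZX]
        exact hXT
      by_cases h₂ : w.1 = v.1
      · rw [h.eq_of_num hw hv h₂, hZY]
        exact hYT
      have := hZ w (List.mem_cons_of_mem _ ((hrest w).2 ⟨hw, h₁, h₂⟩))
      rwa [hU w h₁] at this
    -- Relations that avoid `v` are supplied by the new list of nodes, where the merged node carries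
    -- the number of `u`.
    · have key : ∀ w z : Node, w ∈ live → z ∈ live → w.1 ≠ v.1 → z.1 ≠ v.1 → I.Dom w.1 z.1 →
          I.cnt Z z.1 ≤ I.cnt Z w.1 := by
        have hex : ∀ w : Node, w ∈ live → w.1 ≠ v.1 →
            ∃ w' ∈ mergeNodes (vecOrder ge) I.raw.reach u v ::
              live.filter (fun w => !decide (w.1 = u.1) && !decide (w.1 = v.1)), w'.1 = w.1 := by
          intro w hw hwv
          by_cases h₁ : w.1 = u.1
          · exact ⟨_, List.mem_cons_self, h₁.symm⟩
          · exact ⟨w, List.mem_cons_of_mem _ ((hrest w).2 ⟨hw, h₁, hwv⟩), rfl⟩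
        intro w z hw hz hwv hzv hd
        obtain ⟨w', hw', h₁⟩ := hex w hw hwv
        obtain ⟨z', hz', h₂⟩ := hex z hz hzv
        have := hrel w' hw' z' hz'
        rw [h₁, h₂] at this
        exact this hd
      by_cases h₁ : w.1 = v.1 <;> by_cases h₂ : z.1 = v.1
      · rw [h₁, h₂]
      · rw [h₁] at hwz ⊢
        by_cases h₃ : z.1 = u.1
        · rw [h₃] at hwz ⊢
          exact hresp'.2 hwz
        -- Mergeability splits the relation from `v` to `z` at `u`: the count of `z` is at most that
        -- of `u`, which is at most that of `v`.
        · obtain ⟨h₄, h₅⟩ := (hm z hz h₃ h₂).2 hwz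
          exact (key u z hu hz huv h₂ h₅).trans (hresp'.2 h₄)
      · rw [h₂] at hwz ⊢
        by_cases h₃ : w.1 = u.1
        · rw [h₃] at hwz ⊢
          exact hresp'.1 hwz
        · obtain ⟨h₄, h₅⟩ := (hm w hw h₃ h₁).1 hwz
          exact (hresp'.1 h₅).trans (key w u hw hu h₁ huv h₄)
      · exact key w z hw hz h₁ h₂ hwz

open Classical in
/-- A maximal element of a finite nonempty set, with respect to a transitive relation. -/
theorem exists_maximal_of_trans {α : Type} {r : α → α → Prop} (hrefl : ∀ x, r x x)
    (htrans : ∀ x y z, r x y → r y z → r x z) (s : Finset α) (hs : s.Nonempty) :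
    ∃ x ∈ s, ∀ y ∈ s, r x y → r y x := by
  -- Take `x` with the most predecessors. If `r x y`, the predecessors of `x` are among those of
  -- `y`, so the two sets agree; `y` precedes itself, hence precedes `x`. This tolerates cycles of
  -- the relation.
  obtain ⟨x, hx, hmax⟩ := s.exists_max_image (fun x => (s.filter fun y => r y x).card) hs
  refine ⟨x, hx, fun y hy hxy => ?_⟩
  have hsub : (s.filter fun z => r z x) ⊆ s.filter fun z => r z y := by
    intro z hz
    rw [Finset.mem_filter] at hz ⊢
    exact ⟨hz.1, htrans _ _ _ hz.2 hxy⟩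
  have := Finset.eq_of_subset_of_card_le hsub (hmax y hy)
  have hy' : y ∈ s.filter fun z => r z y := Finset.mem_filter.2 ⟨hy, hrefl y⟩
  rw [← this, Finset.mem_filter] at hy'
  exact hy'.2

open Classical in
-- Dominance may contain cycles, so "lowest" means that whatever is dominated dominates back. For a
-- lowest `v`, relations from `v` to third nodes are therefore two-way, and only the nodes above `v`
-- need control; comparability from tree-likeness provides it.
theorem LiveInv.exists_mergeable {live : List Node} {U : ℕ → I.Committee}
    (h : LiveInv I ge live U) (ht : I.TreeLike) (hlen : 2 ≤ live.length) :
    ∃ u ∈ live, ∃ v ∈ live, mergeable I.raw.reach live u v = true := by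
  have hrefl : ∀ x, I.Dom x x := fun x => .refl
  have htrans : ∀ x y z, I.Dom x y → I.Dom y z → I.Dom x z := fun x y z => .trans
  have hcard : 1 < (live.map fun u => u.1).toFinset.card := by
    rw [List.toFinset_card_of_nodup h.nodup, List.length_map]
    omega
  have hnode : ∀ x, x ∈ (live.map fun u => u.1).toFinset ↔ ∃ u ∈ live, u.1 = x := by
    intro x; simp
  obtain ⟨j, hj, hjmax⟩ := exists_maximal_of_trans hrefl htrans
    (live.map fun u => u.1).toFinset (Finset.card_pos.1 (by omega))
  obtain ⟨v, hv, rfl⟩ := (hnode j).1 hj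
  rcases ((live.map fun u => u.1).toFinset.filter
    fun x => x ≠ v.1 ∧ I.Dom x v.1).eq_empty_or_nonempty with hA | hA
  · obtain ⟨i, hi, hij⟩ := Finset.exists_mem_ne hcard v.1
    obtain ⟨u, hu, rfl⟩ := (hnode i).1 hi
    have hno : ∀ w ∈ live, w.1 ≠ v.1 → ¬ I.Dom w.1 v.1 := by
      intro w hw hwv hd
      have : w.1 ∈ ((live.map fun u => u.1).toFinset.filter fun x => x ≠ v.1 ∧ I.Dom x v.1) :=
        Finset.mem_filter.2 ⟨(hnode _).2 ⟨w, hw, rfl⟩, hwv, hd⟩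
      rw [hA] at this
      exact Finset.notMem_empty _ this
    exact ⟨u, hu, v, hv, (h.mergeable_iff hu hv).2 ⟨hij, fun w hw _ hwv =>
      ⟨fun hd => absurd hd (hno w hw hwv), fun hd =>
        absurd (hjmax _ ((hnode _).2 ⟨w, hw, rfl⟩) hd) (hno w hw hwv)⟩⟩⟩
  · obtain ⟨i, hi, himax⟩ := exists_maximal_of_trans hrefl htrans _ hA
    obtain ⟨hi, hij, hd⟩ := Finset.mem_filter.1 hi
    obtain ⟨u, hu, rfl⟩ := (hnode i).1 hi
    -- A node `w` above `v` is comparable with `u`; if `u` is above `w`, the choice of `u` as a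
    -- lowest such node turns the relation around.
    have hwu : ∀ w ∈ live, w.1 ≠ v.1 → I.Dom w.1 v.1 → I.Dom w.1 u.1 := fun w hw hwv hwd =>
      (ht.dom hwd hd).elim id fun h =>
        himax _ (Finset.mem_filter.2 ⟨(hnode _).2 ⟨w, hw, rfl⟩, hwv, hwd⟩) h
    refine ⟨u, hu, v, hv, (h.mergeable_iff hu hv).2 ⟨hij, fun w hw _ hwv =>
      ⟨fun hwd => ⟨hwu w hw hwv hwd, hd⟩, fun hvw => ?_⟩⟩⟩
    have hwd := hjmax _ ((hnode _).2 ⟨w, hw, rfl⟩) hvw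
    -- Since `w` is also above `v`, the paths from `v` to `w` to `u` and from `u` to `v` to `w` give
    -- both required relations.
    exact ⟨hvw.trans (hwu w hw hwv hwd), hd.trans hvw⟩

theorem LiveInv.mergeRound (hw : IsWeakOrder ge) (hr : FixedCardinalityResponsive ge)
    (ht : I.TreeLike) {live : List Node} {U : ℕ → I.Committee} (h : LiveInv I ge live U)
    (hne : live ≠ []) : (∃ U', LiveInv I ge (mergeRound (vecOrder ge) I.raw.reach live) U') ∧
      mergeRound (vecOrder ge) I.raw.reach live ≠ [] ∧
      (mergeRound (vecOrder ge) I.raw.reach live).length ≤ max 1 (live.length - 1) := by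
  rcases mergeRound_cases (vecOrder ge) I.raw.reach live with ⟨he, hno⟩ | ⟨u, hu, v, hv, hm, he⟩
  · rw [he]
    refine ⟨⟨U, h⟩, hne, ?_⟩
    by_contra hlen
    obtain ⟨u, hu, v, hv, hm⟩ := h.exists_mergeable ht (by omega)
    exact hno u hu v hv hm
  · rw [he]
    refine ⟨⟨_, h.merge hw hr hu hv hm⟩, List.cons_ne_nil _ _, ?_⟩
    have huv := ((h.mergeable_iff hu hv).1 hm).1
    have h₁ : (live.filter fun w => !decide (w.1 = v.1)).length < live.length :=
      List.length_filter_lt_length_iff_exists.2 ⟨v, hv, by simp⟩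
    have h₂ : ((live.filter fun w => !decide (w.1 = v.1)).filter
        fun w => !decide (w.1 = u.1)).length < (live.filter fun w => !decide (w.1 = v.1)).length :=
      List.length_filter_lt_length_iff_exists.2
        ⟨u, List.mem_filter.2 ⟨hu, by simpa using huv⟩, by simp⟩
    rw [List.filter_filter] at h₂
    rw [List.length_cons]
    omega

theorem liveInv_foldl (hw : IsWeakOrder ge) (hr : FixedCardinalityResponsive ge)
    (ht : I.TreeLike) {γ : Type} (l : List γ) {live : List Node} {U : ℕ → I.Committee}
    (h : LiveInv I ge live U) (hne : live ≠ []) :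
    ∃ live', l.foldl (fun live _ => mergeRound (vecOrder ge) I.raw.reach live) live = live' ∧
      (∃ U', LiveInv I ge live' U') ∧ live' ≠ [] ∧ live'.length ≤ max 1 (live.length - l.length) := by
  induction l generalizing live U with
  | nil => exact ⟨live, rfl, ⟨U, h⟩, hne, by simp⟩
  | cons g l ih =>
    obtain ⟨⟨U', h'⟩, hne', hlen⟩ := h.mergeRound hw hr ht hne
    obtain ⟨live', he, hinv, hne'', hlen'⟩ := ih h' hne'
    refine ⟨live', he, hinv, hne'', hlen'.trans ?_⟩
    rw [List.length_cons]
    omega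

/-! ### Selection of the committee and conclusion -/

/-- With the empty label every count is zero, so the signature reduces to the size. All filtered
entries have size `k`, hence pruning leaves at most one, and it beats every feasible committee. -/
theorem select_isSolution (hw : IsWeakOrder ge) {T : List Vec}
    (hsub : SubsetsOf (Finset.univ : I.Committee) T)
    (hsound : ∀ Z, vec Z ∈ T → I.SatisfiesAll Z)
    (hcomplete : ∀ Y, I.SatisfiesAll Y → ∃ X, vec X ∈ T ∧ X.card = Y.card ∧ ge X Y) :
    ∃ out : Option I.Committee, enc (I.raw.select (vecOrder ge) T) = encodeOutput out ∧
      IsSolution I ge out := by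
  set L := T.filter fun v => decide (ones v = I.k) with hL
  have hmemL : ∀ X : I.Committee, vec X ∈ L ↔ vec X ∈ T ∧ X.card = I.k := by
    intro X
    simp [hL, List.mem_filter]
  have hcov : ∀ Y, I.Feasible Y → ∃ X : I.Committee, vec X ∈ prune (vecOrder ge) [] L ∧ ge X Y := by
    intro Y hY
    obtain ⟨X, hXT, hXc, hX⟩ := hcomplete Y hY.2
    obtain ⟨w, hwm, -, ho⟩ := hw.prune_covers (l := []) ((hmemL X).2 ⟨hXT, hXc.trans hY.1⟩)
    obtain ⟨W, -, rfl⟩ := (hsub.filter _) w (mem_prune hwm)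
    exact ⟨W, hwm, hw.2 _ _ _ (vecOrder_vec.1 ho) hX⟩
  have hsel : I.raw.select (vecOrder ge) T =
      listElim none (fun v _ => some v) (prune (vecOrder ge) [] L) := rfl
  rw [hsel]
  have hpw := pairwise_prune (vecOrder ge) [] L
  rcases hP : prune (vecOrder ge) [] L with _ | ⟨v, t⟩
  · refine ⟨none, rfl, fun Y hY => ?_⟩
    obtain ⟨X, hX, -⟩ := hcov Y hY
    rw [hP] at hX
    exact List.not_mem_nil hX
  · have hvm : v ∈ prune (vecOrder ge) [] L := hP ▸ List.mem_cons_self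
    obtain ⟨X, -, rfl⟩ := (hsub.filter _) v (mem_prune hvm)
    obtain ⟨hXT, hXk⟩ := (hmemL X).1 (mem_prune hvm)
    refine ⟨some X, ?_, ⟨hXk, hsound X hXT⟩, fun Y hY => ?_⟩
    · change Data.cons .nil (enc (vec X)) = _
      rw [enc_vec]; rfl
    · obtain ⟨W, hW, hge⟩ := hcov Y hY
      have hWk := ((hmemL W).1 (mem_prune hW)).2
      rw [hP, List.pairwise_cons] at hpw
      rw [hP, List.mem_cons] at hW
      rcases hW with hW | hW
      · rwa [← vec_injective hW]
      · refine absurd (sameSig_iff.2 ⟨?_, ?_⟩) (hpw.1 _ hW)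
        · simp [meet, vand]
        · rw [ones_vec, ones_vec, hXk, hWk]

theorem solve_isSolution (hw : IsWeakOrder ge) (hr : FixedCardinalityResponsive ge)
    (hd : I.DisjointLabels) (ht : I.TreeLike) :
    ∃ out : Option I.Committee, enc (I.raw.solve (vecOrder ge)) = encodeOutput out ∧
      IsSolution I ge out := by
  have hne : I.raw.nodes (vecOrder ge) ≠ [] := by
    simp [Raw.nodes, I.zipIdx_allLabels, Input.allNums]
  obtain ⟨live, he, ⟨U, h⟩, hne', hlen⟩ :=
    liveInv_foldl hw hr ht (I.raw.nodes (vecOrder ge)) (liveInv_nodes hw hr hd) hne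
  -- There were as many rounds as nodes, so at most one node is left, and merging never empties the
  -- list.
  obtain ⟨u, rfl⟩ : ∃ u, live = [u] := by
    rw [← List.length_eq_one_iff]
    have := List.length_pos_iff.2 hne'
    omega
  have hU : U u.1 = Finset.univ := by
    rw [Finset.eq_univ_iff_forall]
    intro c
    obtain ⟨w, hw, hc⟩ := h.cover c
    rwa [List.mem_singleton.1 hw] at hc
  rw [Raw.solve, he, listElim_cons]
  have hu : u ∈ [u] := List.mem_singleton_self u
  refine select_isSolution hw (hU ▸ h.subsets u hu) (fun Z hZ => ?_) fun Y hY => ?_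
  -- With one node, whose block is the whole candidate set, the dominance condition compares a count
  -- with itself.
  · refine h.sound Z (fun w hw => ?_) fun w hw z hz _ => ?_
    · rw [List.mem_singleton.1 hw, hU, Finset.inter_univ]
      exact hZ
    · rw [List.mem_singleton.1 hw, List.mem_singleton.1 hz]
  · obtain ⟨X, ⟨-, hc, hge⟩, hT, -⟩ := h.complete Y hY u hu
    rw [hU, Finset.inter_univ] at hc hge
    exact ⟨X, hT, hc, hge⟩

end ConstrainedElection

theorem mainTheorem1 :
    ∃ M : Prog, ∀ Q : Polynomial ℕ, ∃ P : Polynomial ℕ,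
      ∀ (I : Input) (ge : I.Committee → I.Committee → Prop) (R : Prog),
        IsWeakOrder ge →
        FixedCardinalityResponsive ge →
        ComputesOrder Q R I ge →
        I.DisjointLabels →
        I.TreeLike →
        ∃ out : Option I.Committee,
          RunsWithin P (M.link R) I.encode (encodeOutput out) ∧ IsSolution I ge out := by
  obtain ⟨M, hM⟩ := exists_solver
  refine ⟨M, fun Q => ?_⟩
  obtain ⟨P, hP⟩ := hM Q
  refine ⟨P, fun I ge R hw hr hR hd ht => ?_⟩
  obtain ⟨out, he, hout⟩ := solve_isSolution hw hr hd ht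
  exact ⟨out, he ▸ hP I ge R hR, hout⟩
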